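/- Let $D\subset\mathbb R^m$ be open and convex, let $\mathbf f=(\mathbf f_1,\mathbf f_2)$ with $\mathbf f_k\in C^1(D;\mathbb R^m)$, let $T>0$, and let $\mathbf u_{\rm ex}\in C^3([0,T]\times\mathbb R^2;\mathbb R^m)$ be a $D$-valued classical solution of $\partial_t\mathbf u+\operatorname{div}\mathbf f(\mathbf u)=0$ on $[0,T]\times\mathbb R^2$. ($\mathbf f$ is extended arbitrarily outside $D$; time derivatives at $0$ and $T$ are one-sided.) Let $\varphi\in C^1(\mathbb R^2)$ be real-valued with compact support. **Mesh and local spaces.** Consider conforming, locally finite triangulations $\mathcal T$ of $\mathbb R^2$ by nondegenerate closed triangles $K$, with area $|K|$, diameter $h_K$, centroid $\mathbf x_K$, barycentric coordinates $\lambda_1,\lambda_2,\lambda_3$, vertices $\sigma_1,\sigma_2,\sigma_3$, and $\sigma_{3+i}$ the midpoint of $[\sigma_i,\sigma_{i+1}]$ ($i$ modulo $3$). On $K$ put $\varphi_7=\bar\varphi=60\lambda_1\lambda_2\lambda_3$ and, for $i=1,2,3$, $\varphi_i=\lambda_i(2\lambda_i-1)$, $\varphi_{3+i}=4\lambda_i\lambda_{i+1}-\tfrac13\bar\varphi$.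 The interpolant of $\mathbf v$ on $K$ is $\pi\mathbf v=\sum_{j=1}^6\mathbf v(\sigma_j)\varphi_j+\bar{\mathbf v}_K\bar\varphi$, where $\bar{\mathbf v}_K=\frac1{|K|}\int_K\mathbf v\,d\mathbf x$. With the mass matrix $(M_K)_{ij}=\int_K\varphi_i\varphi_j\,d\mathbf x$ and the outward unit normal $\mathbf n$, the residuals are $$\Phi_{K,\sigma_j}(\mathbf v)=\sum_{l=1}^7(M_K^{-1})_{jl}\Big(-\int_K\nabla\varphi_l\cdot\mathbf f(\mathbf v)\,d\mathbf x+\oint_{\partial K}\varphi_l\,\mathbf f(\mathbf v)\cdot\mathbf n\,d\ell\Big),\qquad j=1,\dots,6.$$ Let $\beta_1=\beta_2=\beta_3=\frac1{20}$ and $\beta_4=\beta_5=\beta_6=\frac2{15}$ (with weight $\frac9{20}$ at $\mathbf x_K$ this is a quadrature formula that is exact on $\operatorname{span}\{\varphi_1,\dots,\varphi_7\}$). **Scheme.** The semi-discrete third-order PAMPA scheme is $$|K|\frac{d\bar{\mathbf u}_K}{dt}+\oint_{\partial K}\mathbf f(\mathbf u_h)\cdot\mathbf n\,d\ell=0,\qquad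 \frac{d\mathbf u_\sigma}{dt}+\sum_{K\ni\sigma}\omega_{K,\sigma}\Phi_{K,\sigma}(\mathbf u_h)=0,$$ where $\omega_{K,\sigma}\in\mathbb R^{m\times m}$ are weights, which may depend on $\mathbf u_h$ and below are taken at $\mathbf u_h=\pi\mathbf u_{\rm ex}(t)$. Here $\sigma$ runs over all vertices and edge midpoints. **Weak truncation error.** Put $$\varepsilon(\varphi,\mathbf u_{\rm ex})=\sum_K\varphi(\mathbf x_K)\Big(|K|\frac{d}{dt}\overline{(\pi\mathbf u_{\rm ex})}_K+\oint_{\partial K}\mathbf f(\mathbf w)\cdot\mathbf n\,d\ell\Big)+\sum_K\sum_{j=1}^6\beta_j|K|\big(\varphi(\sigma_j)-\varphi(\mathbf x_K)\big)\,\omega_{K,\sigma_j}\Big(\frac{d\mathbf u_{\rm ex}}{dt}(\sigma_j)+\Phi_{K,\sigma_j}(\pi\mathbf u_{\rm ex})\Big),$$ where $\mathbf w$ is either $\pi\mathbf u_{\rm ex}$ or $\mathbf u_{\rm ex}$. Let $\tilde\varepsilon(\varphi,\mathbf u_{\rm ex})$ be the expression in which $\mathbf w=\pi\mathbf u_{\rm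 ex}$ and $\omega_{K,\sigma_j}\big(\frac{d\mathbf u_{\rm ex}}{dt}(\sigma_j)+\Phi_{K,\sigma_j}(\pi\mathbf u_{\rm ex})\big)$ is replaced by the point-value defect of the scheme, $\frac{d\mathbf u_{\rm ex}}{dt}(\sigma_j)+\sum_{K'\ni\sigma_j}\omega_{K',\sigma_j}\Phi_{K',\sigma_j}(\pi\mathbf u_{\rm ex})$. **Claim.** On regular meshes, $\varepsilon(\varphi,\mathbf u_{\rm ex})=O(h^3)$ for both choices of $\mathbf w$, and $\tilde\varepsilon(\varphi,\mathbf u_{\rm ex})=O(h^3)$. Precisely: for all $\gamma,C_\omega\in\mathbb R$ there are $C$ and $h_0>0$, depending only on $D,\mathbf f,T,\mathbf u_{\rm ex},\varphi,\gamma,C_\omega$, such that for all $h\le h_0$, all triangulations $\mathcal T$ with $h_K\le h$ and $h_K^2\le\gamma|K|$ for every $K$, all $t\in[0,T]$, and all weights with $\sum_{K\ni\sigma}\omega_{K,\sigma}=\mathrm{Id}$ for every $\sigma$ and $\|\omega_{K,\sigma}\|\le C_\omega$ for all $K,\sigma$, these three quantities have norm at most $C\,h^3$ at time $t$. -/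

import Mathlib

open Set MeasureTheory
open scoped BigOperators Topology

noncomputable section

namespace Pampa

/-- The plane with its Euclidean norm and Lebesgue measure. -/
abbrev Plane : Type := EuclideanSpace ℝ (Fin 2)

/-- The space `ℝ^m` of values of the conserved variables. -/
abbrev State (m : ℕ) : Type := EuclideanSpace ℝ (Fin m)

/-- A nondegenerate triangle, given by its three affinely independent vertices `K 0, K 1, K 2`.
The barycentric coordinates are the affine functions `K.coord i`. -/
abbrev Tri : Type := AffineBasis (Fin 3) ℝ Plane

/-- Local point nodes: `Sum.inl i` is the vertex `K i`, and `Sum.inr i` is the midpoint of the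
edge `[K i, K (i + 1)]` (indices modulo 3). -/
abbrev LocalNode : Type := Fin 3 ⊕ Fin 3

/-- The seven local degrees of freedom: six point values, and the cell average `Sum.inr ()`. -/
abbrev LocalDof : Type := LocalNode ⊕ Unit

/-- The closed triangle as a subset of the plane. -/
def carrier (K : Tri) : Set Plane := convexHull ℝ (range K)

def area (K : Tri) : ℝ := volume.real (carrier K)

def centroid (K : Tri) : Plane := (3⁻¹ : ℝ) • ∑ i, K i

/-- The point carrying a local node. -/
def node (K : Tri) : LocalNode → Plane
  | Sum.inl i => K i
  | Sum.inr i => midpoint ℝ (K i) (K (i + 1))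

/-- The cubic bubble `60 λ₁ λ₂ λ₃`, whose mean value over the triangle is one. -/
def bubble (K : Tri) (x : Plane) : ℝ := 60 * ∏ i, K.coord i x

/-- The local basis functions: `λ_i (2 λ_i - 1)` at the vertices,
`4 λ_i λ_{i+1} - bubble / 3` at the midpoints, and the bubble for the cell average. -/
def shape (K : Tri) : LocalDof → Plane → ℝ
  | Sum.inl (Sum.inl i) => fun x => K.coord i x * (2 * K.coord i x - 1)
  | Sum.inl (Sum.inr i) => fun x => 4 * K.coord i x * K.coord (i + 1) x - bubble K x / 3
  | Sum.inr _ => bubble K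

/-- The mean value of `v` over the triangle. -/
def cellAverage {m : ℕ} (K : Tri) (v : Plane → State m) : State m :=
  (area K)⁻¹ • ∫ x in carrier K, v x

/-- The interpolant of `v` on the triangle, with the point values of `v` at the six nodes and
with the cell average of `v`. -/
def interp {m : ℕ} (K : Tri) (v : Plane → State m) (x : Plane) : State m :=
  ∑ j : LocalNode, shape K (Sum.inl j) x • v (node K j)
    + shape K (Sum.inr ()) x • cellAverage K v

/-- The mass matrix `∫_K φ_i φ_j`. -/
def massMatrix (K : Tri) : Matrix LocalDof LocalDof ℝ :=
  Matrix.of fun i j => ∫ x in carrier K, shape K i x * shape K j x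

/-- `1` if the vertices are listed counterclockwise and `-1` if they are listed clockwise. -/
def orient (K : Tri) : ℝ :=
  Real.sign ((K 1 0 - K 0 0) * (K 2 1 - K 0 1) - (K 1 1 - K 0 1) * (K 2 0 - K 0 0))

/-- The outward normal to the edge `[K i, K (i + 1)]`, multiplied by the length of that edge. -/
def edgeNormal (K : Tri) (i : Fin 3) : Plane :=
  orient K • !₂[K (i + 1) 1 - K i 1, -(K (i + 1) 0 - K i 0)]

/-- The line integral over the boundary of the triangle of `w (g · n)`, with `g = (g 0, g 1)` and
`n` the outward unit normal. Every edge is parametrized by `s ∈ [0, 1]`; the length element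
`|e| ds` is taken into account by the normalization of `edgeNormal`. -/
def boundaryFlux {m : ℕ} (K : Tri) (w : Plane → ℝ) (g : Fin 2 → Plane → State m) : State m :=
  ∑ i : Fin 3, ∫ s in (0 : ℝ)..1,
    w (AffineMap.lineMap (K i) (K (i + 1)) s) •
      ∑ k : Fin 2, edgeNormal K i k • g k (AffineMap.lineMap (K i) (K (i + 1)) s)

/-- The discontinuous Galerkin load
`- ∫_K ∇φ_l · f(v) dx + ∮_{∂K} φ_l f(v) · n dℓ` of the local basis function `φ_l`. -/
def dgLoad {m : ℕ} (K : Tri) (f : Fin 2 → State m → State m) (v : Plane → State m)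
    (l : LocalDof) : State m :=
  -(∫ x in carrier K,
      ∑ k : Fin 2, fderiv ℝ (shape K l) x (EuclideanSpace.single k 1) • f k (v x))
    + boundaryFlux K (shape K l) (fun k x => f k (v x))

/-- The point residuals `Φ_{K,σ_j}(v)`: the components of `M_K⁻¹ F_K(v)` at the point nodes,
`M_K` being the mass matrix and `F_K(v)` the vector of all seven loads. -/
def residual {m : ℕ} (K : Tri) (f : Fin 2 → State m → State m) (v : Plane → State m)
    (j : LocalNode) : State m :=
  ∑ l : LocalDof, (massMatrix K)⁻¹ (Sum.inl j) l • dgLoad K f v l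

/-- The weights `β_j` of the Simpson-like formula at the vertices and at the midpoints (the
remaining weight `9/20` belongs to the centroid). -/
def beta : LocalNode → ℝ
  | Sum.inl _ => 1 / 20
  | Sum.inr _ => 2 / 15

/-- A conforming, locally finite triangulation of the whole plane. -/
structure Triangulation where
  /-- the index set of the triangles -/
  Cell : Type
  /-- the triangles -/
  tri : Cell → Tri
  /-- different cells are different triangles -/
  distinct : ∀ K K' : Cell, range (tri K) = range (tri K') → K = K'
  /-- the triangles cover the plane -/
  covers : ∀ x : Plane, ∃ K, x ∈ carrier (tri K)
  /-- two different triangles meet in the convex hull of their common vertices, that is, in a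
  common edge, in a common vertex or not at all -/
  conforming : ∀ K K' : Cell, K ≠ K' →
    carrier (tri K) ∩ carrier (tri K') = convexHull ℝ (range (tri K) ∩ range (tri K'))
  /-- the triangulation is locally finite -/
  locallyFinite : LocallyFinite fun K => carrier (tri K)

/-- All triangles have diameter at most `h`. -/
def Triangulation.MeshSizeLE (𝒯 : Triangulation) (h : ℝ) : Prop :=
  ∀ K, Metric.diam (carrier (𝒯.tri K)) ≤ h

/-- Regularity of the mesh: `h_K ^ 2 ≤ γ |K|` for all triangles, `h_K` being the diameter. -/
def Triangulation.Regular (𝒯 : Triangulation) (γ : ℝ) : Prop :=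
  ∀ K, Metric.diam (carrier (𝒯.tri K)) ^ 2 ≤ γ * area (𝒯.tri K)

/-- At every degree of freedom `σ` that is a point value, the weights `ω_{K,σ}` of the triangles
having `σ` as a node sum up to the identity. -/
def Triangulation.SumToId {m : ℕ} (𝒯 : Triangulation)
    (ω : 𝒯.Cell → LocalNode → (State m →L[ℝ] State m)) : Prop :=
  ∀ K₀ j₀, ∑ᶠ (p : 𝒯.Cell × LocalNode) (_ : node (𝒯.tri p.1) p.2 = node (𝒯.tri K₀) j₀),
    ω p.1 p.2 = ContinuousLinearMap.id ℝ (State m)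

/-- `u` is a classical solution of class `C³`, with values in `D`, of
`∂_t u + div f(u) = 0` on `[0, T] × ℝ²`. Time derivatives are one-sided at `0` and `T`. -/
structure IsSmoothSolution {m : ℕ} (D : Set (State m)) (f : Fin 2 → State m → State m) (T : ℝ)
    (u : ℝ → Plane → State m) : Prop where
  contDiffOn : ContDiffOn ℝ 3 (fun p : ℝ × Plane => u p.1 p.2) (Icc 0 T ×ˢ univ)
  mem : ∀ t ∈ Icc 0 T, ∀ x, u t x ∈ D
  equation : ∀ t ∈ Icc 0 T, ∀ x,
    derivWithin (fun s => u s x) (Icc 0 T) t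
      + ∑ k : Fin 2, fderiv ℝ (fun y => f k (u t y)) x (EuclideanSpace.single k 1) = 0

/-- The update of the cell average, multiplied by `|K|`, applied at time `t` to the interpolant of
`u`: `|K| d/dt (mean of π u over K) + ∮_{∂K} f(trace) · n dℓ`. -/
def cellDefect {m : ℕ} (K : Tri) (f : Fin 2 → State m → State m) (T : ℝ)
    (u : ℝ → Plane → State m) (t : ℝ) (trace : Plane → State m) : State m :=
  area K • derivWithin (fun s => cellAverage K (interp K (u s))) (Icc 0 T) t
    + boundaryFlux K (fun _ => 1) (fun k x => f k (trace x))

/-- The weak truncation error at time `t ∈ [0, T]`. The boundary fluxes of the cell averages are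
computed from the functions `trace K`, and `ω` are the weights at the time `t`. For `φ` of compact
support both sums have only finitely many nonzero terms. -/
def truncationError {m : ℕ} (𝒯 : Triangulation) (f : Fin 2 → State m → State m) (T : ℝ)
    (u : ℝ → Plane → State m) (φ : Plane → ℝ) (t : ℝ)
    (ω : 𝒯.Cell → LocalNode → (State m →L[ℝ] State m))
    (trace : 𝒯.Cell → Plane → State m) : State m :=
  (∑ᶠ K : 𝒯.Cell, φ (centroid (𝒯.tri K)) • cellDefect (𝒯.tri K) f T u t (trace K))
  + ∑ᶠ K : 𝒯.Cell, ∑ j : LocalNode,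
      (beta j * area (𝒯.tri K) * (φ (node (𝒯.tri K) j) - φ (centroid (𝒯.tri K)))) •
        ω K j (derivWithin (fun s => u s (node (𝒯.tri K) j)) (Icc 0 T) t
          + residual (𝒯.tri K) f (interp (𝒯.tri K) (u t)) j)

/-- The update `d/dt u_σ + ∑_{K ∋ σ} ω_{K,σ} Φ_{K,σ}` of the point value at `σ`, applied at time
`t` to the interpolant of `u`. -/
def pointDefect {m : ℕ} (𝒯 : Triangulation) (f : Fin 2 → State m → State m) (T : ℝ)
    (u : ℝ → Plane → State m) (t : ℝ)
    (ω : 𝒯.Cell → LocalNode → (State m →L[ℝ] State m)) (σ : Plane) : State m :=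
  derivWithin (fun s => u s σ) (Icc 0 T) t
    + ∑ᶠ (p : 𝒯.Cell × LocalNode) (_ : node (𝒯.tri p.1) p.2 = σ),
        ω p.1 p.2 (residual (𝒯.tri p.1) f (interp (𝒯.tri p.1) (u t)) p.2)

/-- The defect of the semi-discrete scheme at the interpolant of `u`, tested against `φ` by the
Simpson-like formula, in which the centroid value is eliminated in favour of the cell average. -/
def testedDefect {m : ℕ} (𝒯 : Triangulation) (f : Fin 2 → State m → State m) (T : ℝ)
    (u : ℝ → Plane → State m) (φ : Plane → ℝ) (t : ℝ)
    (ω : 𝒯.Cell → LocalNode → (State m →L[ℝ] State m)) : State m :=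
  (∑ᶠ K : 𝒯.Cell, φ (centroid (𝒯.tri K)) •
      cellDefect (𝒯.tri K) f T u t (interp (𝒯.tri K) (u t)))
  + ∑ᶠ K : 𝒯.Cell, ∑ j : LocalNode,
      (beta j * area (𝒯.tri K) * (φ (node (𝒯.tri K) j) - φ (centroid (𝒯.tri K)))) •
        pointDefect 𝒯 f T u t ω (node (𝒯.tri K) j)

end Pampa

end

namespace Pampa

/-! Counting orders naively loses one power of `h`, and a cancellation restores it. Cell averages:
interpolation preserves the mean, so integrating the equation over `K` turns the defect into the
boundary flux of `f(w) - f(u)` (`IsSmoothSolution.cellDefect_eq`). It vanishes for `w = u`. For `w =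
πu` the integrand is `O(h^3)` because `π` reproduces quadratics (`norm_interp_sub_le`) and `f` is
locally Lipschitz. This gives `O(h^4)` per cell and only `O(h^2)` over the roughly `h^(-2)` cells
that meet the support of `φ`. However, `πu` is continuous across edges
(`Triangulation.interp_eq_interp`), so the boundary fluxes of the continuous, compactly supported
field `φ (f(πu) - f(u))` sum to zero (`sum_boundaryFlux_eq_zero`). Subtracting this sum replaces
`φ(x_K)` by `φ(x_K) - φ(x) = O(h)` and gains the missing order (`norm_sum_flux_le`). Point values:
with the exact `u`, integration by parts identifies the load with the moments of `-∂_t u`, and `M⁻¹`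
turns these into an `L²` projection, exact on quadratics. Since `∂_t u` is only `C²` in space, a
Taylor polynomial of degree one leaves `O(h^2)`. Replacing `u` by `πu` changes the loads by `O(h ·
h^3)`, while `M⁻¹ = O(1/|K|)`; by shape regularity this is again `O(h^2)` (`norm_add_residual_le`).
The factor `φ(σ) - φ(x_K) = O(h)` supplies the third order, and the areas sum to a bounded quantity.
For the defect of the scheme itself, `∑ ω = Id` writes the point defect as a weighted sum of these
local errors over the cells at `σ`. Shape regularity bounds the number of such cells
(`card_le_of_mem`). -/

/-! ### Area integrals over triangles as iterated integrals -/

/-- The determinant of two vectors of the plane. -/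
def cross (a b : Plane) : ℝ := a 0 * b 1 - a 1 * b 0

/-- The reference triangle. -/
def refTri : Set Plane := {y | 0 ≤ y 0 ∧ 0 ≤ y 1 ∧ y 0 + y 1 ≤ 1}

lemma isClosed_refTri : IsClosed refTri := by
  have h0 : Continuous fun y : Plane => y 0 := by fun_prop
  have h1 : Continuous fun y : Plane => y 1 := by fun_prop
  exact (isClosed_le continuous_const h0).inter ((isClosed_le continuous_const h1).inter
    (isClosed_le (h0.add h1) continuous_const))

lemma isCompact_refTri : IsCompact refTri := by
  refine Metric.isCompact_of_isClosed_isBounded isClosed_refTri ?_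
  refine (Metric.isBounded_closedBall (x := (0 : Plane)) (r := 2)).subset ?_
  intro y hy
  obtain ⟨h0, h1, h2⟩ := hy
  rw [mem_closedBall_zero_iff, EuclideanSpace.norm_eq, Fin.sum_univ_two]
  refine Real.sqrt_le_iff.2 ⟨by norm_num, ?_⟩
  simp only [Real.norm_eq_abs, sq_abs]
  nlinarith

section RefIntegral

variable {E : Type*} [NormedAddCommGroup E] [NormedSpace ℝ E]

lemma integral_refTri {F : Plane → E} (hF : ContinuousOn F refTri) :
    ∫ y in refTri, F y = ∫ s in (0 : ℝ)..1, ∫ r in (0 : ℝ)..(1 - s), F !₂[s, r] := by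
  have hm : MeasurableSet refTri := isClosed_refTri.measurableSet
  have hint : IntegrableOn F refTri := hF.integrableOn_compact isCompact_refTri
  let e : ℝ × ℝ → Plane := fun p => !₂[p.1, p.2]
  have he : MeasurePreserving e volume volume := by
    have h1 := (volume_preserving_finTwoArrow ℝ).symm
    exact (PiLp.volume_preserving_toLp (Fin 2)).comp h1
  have hemb : MeasurableEmbedding e := by
    exact ((MeasurableEquiv.finTwoArrow (α := ℝ)).symm.trans
      (MeasurableEquiv.toLp 2 (Fin 2 → ℝ))).measurableEmbedding
  rw [← integral_indicator hm, ← he.integral_comp hemb]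
  have hint2 : Integrable (fun p => refTri.indicator F (e p)) (volume : Measure (ℝ × ℝ)) :=
    (he.integrable_comp_emb hemb).2 ((integrable_indicator_iff hm).2 hint)
  rw [Measure.volume_eq_prod] at hint2 ⊢
  rw [integral_prod _ hint2, intervalIntegral.integral_of_le zero_le_one,
    ← integral_Icc_eq_integral_Ioc, ← integral_indicator measurableSet_Icc]
  refine integral_congr_ae (Filter.Eventually.of_forall fun s => ?_)
  by_cases hs : s ∈ Icc (0 : ℝ) 1
  · simp only [indicator_of_mem hs]
    rw [intervalIntegral.integral_of_le (by linarith [hs.2]), ← integral_Icc_eq_integral_Ioc,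
      ← integral_indicator measurableSet_Icc]
    refine integral_congr_ae (Filter.Eventually.of_forall fun r => ?_)
    have : e (s, r) ∈ refTri ↔ r ∈ Icc 0 (1 - s) := by
      simp only [refTri, e, mem_Icc]
      constructor
      · rintro ⟨_, h1, h2⟩
        simp at h1 h2
        exact ⟨h1, by linarith⟩
      · rintro ⟨h1, h2⟩
        refine ⟨?_, ?_, ?_⟩ <;> simp <;> linarith [hs.1]
    by_cases hr : r ∈ Icc 0 (1 - s)
    · simp only [indicator_of_mem hr, indicator_of_mem (this.2 hr)]; rfl
    · simp only [indicator_of_notMem hr, indicator_of_notMem (fun h => hr (this.1 h))]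
  · simp only [indicator_of_notMem hs]
    rw [← integral_zero ℝ E]
    refine integral_congr_ae (Filter.Eventually.of_forall fun r => ?_)
    refine indicator_of_notMem (fun h => hs ?_) _
    obtain ⟨h0, h1, h2⟩ := h
    simp [e] at h0 h1 h2
    exact ⟨h0, by linarith⟩

/-- The affine parametrization of a triangle over the reference triangle. -/
def param (P a b : Plane) (y : Plane) : Plane := P + y 0 • a + y 1 • b

/-- The linear part of `param`. -/
noncomputable def paramLin (a b : Plane) : Plane →L[ℝ] Plane :=
  (EuclideanSpace.proj 0 : Plane →L[ℝ] ℝ).smulRight a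
    + (EuclideanSpace.proj 1 : Plane →L[ℝ] ℝ).smulRight b

lemma hasFDerivAt_param (P a b y : Plane) : HasFDerivAt (param P a b) (paramLin a b) y := by
  have : param P a b = fun y => P + paramLin a b y := by
    ext y
    simp [param, paramLin, add_assoc]
  rw [this]
  exact (paramLin a b).hasFDerivAt.const_add P

lemma det_paramLin (a b : Plane) : (paramLin a b).det = cross a b := by
  rw [ContinuousLinearMap.det,
    ← LinearMap.det_toMatrix (EuclideanSpace.basisFun (Fin 2) ℝ).toBasis, Matrix.det_fin_two]
  simp [LinearMap.toMatrix_apply, paramLin, cross]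
  ring

lemma param_injective {a b : Plane} (h : cross a b ≠ 0) (P : Plane) :
    Function.Injective (param P a b) := by
  intro x y hxy
  have h0 := congrArg (fun v : Plane => v 0) hxy
  have h1 := congrArg (fun v : Plane => v 1) hxy
  simp [param] at h0 h1
  have e0 : (x 0 - y 0) * cross a b = 0 := by
    unfold cross; linear_combination b 1 * h0 - b 0 * h1
  have e1 : (x 1 - y 1) * cross a b = 0 := by
    unfold cross; linear_combination a 0 * h1 - a 1 * h0
  have e0' := (mul_eq_zero.1 e0).resolve_right h
  have e1' := (mul_eq_zero.1 e1).resolve_right h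
  ext i
  fin_cases i
  · simpa using sub_eq_zero.1 e0'
  · simpa using sub_eq_zero.1 e1'

lemma continuous_param (P a b : Plane) : Continuous (param P a b) := by
  unfold param; fun_prop

lemma integral_param {P a b : Plane} (h : cross a b ≠ 0) {F : Plane → E}
    (hF : ContinuousOn F (param P a b '' refTri)) :
    ∫ x in param P a b '' refTri, F x =
      |cross a b| • ∫ s in (0 : ℝ)..1, ∫ r in (0 : ℝ)..(1 - s), F (P + s • a + r • b) := by
  rw [integral_image_eq_integral_abs_det_fderiv_smul volume isClosed_refTri.measurableSet
    (fun y _ => (hasFDerivAt_param P a b y).hasFDerivWithinAt) (param_injective h P).injOn]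
  simp only [det_paramLin]
  rw [integral_smul, integral_refTri (F := fun y => F (param P a b y))]
  · simp [param]
  · exact hF.comp (continuous_param P a b).continuousOn (mapsTo_image _ _)

/-- Exchanging the two edge vectors yields the other order of iterated integration without a second
use of Fubini. -/
lemma param_swap (P a b : Plane) : param P b a '' refTri = param P a b '' refTri := by
  have key : ∀ a b, param P b a '' refTri ⊆ param P a b '' refTri := by
    rintro a b _ ⟨y, ⟨h0, h1, h2⟩, rfl⟩
    refine ⟨!₂[y 1, y 0], ⟨?_, ?_, ?_⟩, ?_⟩
    · simpa using h1
    · simpa using h0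
    · simpa [add_comm] using h2
    · simp [param, add_right_comm]
  exact (key a b).antisymm (key b a)

end RefIntegral

/-! ### Edge vectors, signed area and barycentric coordinates -/

/-- The edge vectors at the vertex `K 0`. -/
noncomputable def eA (K : Tri) : Plane := K 1 - K 0

/-- The second edge vector at the vertex `K 0`. -/
noncomputable def eB (K : Tri) : Plane := K 2 - K 0

/-- The signed double area. -/
noncomputable def det (K : Tri) : ℝ := cross (eA K) (eB K)

lemma orient_eq (K : Tri) : orient K = Real.sign (det K) := by
  simp [orient, det, cross, eA, eB]

lemma coord_sub (K : Tri) (i : Fin 3) (x y : Plane) :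
    K.coord i x - K.coord i y = (K.coord i).linear (x - y) := by
  simpa using ((K.coord i).linearMap_vsub x y).symm

lemma coord_add (K : Tri) (i : Fin 3) (x v : Plane) :
    K.coord i (x + v) = K.coord i x + (K.coord i).linear v := by
  rw [← sub_eq_iff_eq_add', coord_sub, add_sub_cancel_left]

lemma linear_edge (K : Tri) (i j l : Fin 3) :
    (K.coord i).linear (K j - K l) = (if i = j then 1 else 0) - (if i = l then 1 else 0) := by
  rw [← coord_sub, K.coord_apply, K.coord_apply]

/-- Cramer's rule in the basis of the two edge vectors, kept free of division. -/
lemma det_smul_eq (K : Tri) (v : Plane) :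
    det K • v = cross v (eB K) • eA K + cross (eA K) v • eB K := by
  ext i
  fin_cases i <;> simp [det, cross] <;> ring

/-- If the determinant were zero, the linear part of `λ_1` applied to Cramer's rule would make `eB
K` parallel to every vector, hence zero. But `λ_2` grows by one along `eB K`. -/
lemma det_ne_zero (K : Tri) : det K ≠ 0 := by
  intro h
  have hv : ∀ v : Plane, cross v (eB K) = 0 := by
    intro v
    have h1 := congrArg (K.coord 1).linear (det_smul_eq K v)
    rw [h] at h1
    rw [zero_smul, map_zero, map_add, map_smul, map_smul, eA, eB, linear_edge, linear_edge] at h1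
    simpa [eB] using h1.symm
  have hb : eB K = 0 := by
    ext i
    have h0 := hv (EuclideanSpace.single 0 1)
    have h1 := hv (EuclideanSpace.single 1 1)
    simp [cross] at h0 h1
    fin_cases i <;> simp [h0, h1]
  have := linear_edge K 2 2 0
  change (K.coord 2).linear (eB K) = _ at this
  rw [hb] at this
  simp at this

lemma coord_param (K : Tri) (s r : ℝ) (i : Fin 3) :
    K.coord i (K 0 + s • eA K + r • eB K) = ![1 - s - r, s, r] i := by
  rw [coord_add, coord_add, map_smul, map_smul, eA, eB, linear_edge, linear_edge, K.coord_apply]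
  fin_cases i <;> simp
  ring

lemma eq_of_coord (K : Tri) (x : Plane) :
    x = K 0 + K.coord 1 x • eA K + K.coord 2 x • eB K := by
  have h := K.linear_combination_coord_eq_self x
  have h1 := K.sum_coord_apply_eq_one x
  rw [Fin.sum_univ_three] at h h1
  nth_rewrite 1 [← h]
  have : K.coord 0 x = 1 - K.coord 1 x - K.coord 2 x := by linarith
  rw [this, eA, eB]
  module

lemma mem_carrier_iff (K : Tri) (x : Plane) : x ∈ carrier K ↔ ∀ i, 0 ≤ K.coord i x := by
  rw [carrier, K.convexHull_eq_nonneg_coord]; rfl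

lemma carrier_eq (K : Tri) : carrier K = param (K 0) (eA K) (eB K) '' refTri := by
  ext x
  rw [mem_carrier_iff]
  constructor
  · intro h
    have h1 := K.sum_coord_apply_eq_one x
    rw [Fin.sum_univ_three] at h1
    refine ⟨!₂[K.coord 1 x, K.coord 2 x], ⟨?_, ?_, ?_⟩, ?_⟩
    · simpa using h 1
    · simpa using h 2
    · have := h 0
      simp; linarith
    · simpa [param] using (eq_of_coord K x).symm
  · rintro ⟨y, ⟨h0, h1, h2⟩, rfl⟩ i
    rw [param, coord_param]
    fin_cases i <;> simp <;> linarith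

lemma isCompact_carrier (K : Tri) : IsCompact (carrier K) := by
  rw [carrier_eq]
  exact isCompact_refTri.image (continuous_param _ _ _)

lemma convex_carrier (K : Tri) : Convex ℝ (carrier K) := convex_convexHull _ _

lemma vertex_mem (K : Tri) (i : Fin 3) : K i ∈ carrier K :=
  subset_convexHull _ _ (mem_range_self i)

lemma node_mem (K : Tri) (j : LocalNode) : node K j ∈ carrier K := by
  rcases j with i | i
  · exact vertex_mem K i
  · exact (convex_carrier K).midpoint_mem (vertex_mem K i) (vertex_mem K _)

lemma centroid_mem (K : Tri) : centroid K ∈ carrier K := by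
  have : centroid K = ∑ i : Fin 3, (3⁻¹ : ℝ) • K i := by rw [centroid, Finset.smul_sum]
  rw [this]
  exact (convex_carrier K).sum_mem (fun _ _ => by norm_num) (by simp) fun i _ => vertex_mem K i

lemma lineMap_mem (K : Tri) (i j : Fin 3) {s : ℝ} (hs : s ∈ Icc (0 : ℝ) 1) :
    AffineMap.lineMap (K i) (K j) s ∈ carrier K :=
  (convex_carrier K).lineMap_mem (vertex_mem K i) (vertex_mem K j) hs

section

variable {E : Type*} [NormedAddCommGroup E] [NormedSpace ℝ E]

lemma integral_carrier (K : Tri) {F : Plane → E} (hF : ContinuousOn F (carrier K)) :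
    ∫ x in carrier K, F x = |det K| •
      ∫ s in (0 : ℝ)..1, ∫ r in (0 : ℝ)..(1 - s), F (K 0 + s • eA K + r • eB K) := by
  rw [carrier_eq] at hF ⊢
  exact integral_param (det_ne_zero K) hF

lemma integral_carrier_swap (K : Tri) {F : Plane → E} (hF : ContinuousOn F (carrier K)) :
    ∫ x in carrier K, F x = |det K| •
      ∫ r in (0 : ℝ)..1, ∫ s in (0 : ℝ)..(1 - r), F (K 0 + s • eA K + r • eB K) := by
  have hc : cross (eB K) (eA K) = - det K := by unfold det cross; ring
  rw [carrier_eq, ← param_swap] at hF ⊢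
  rw [integral_param (by rw [hc]; exact neg_ne_zero.2 (det_ne_zero K)) hF, hc, abs_neg]
  simp only [add_right_comm]

end

/-! ### Edge integrals and the divergence theorem -/

/-- The integral of a function along an edge, parametrized by `[0, 1]`. -/
noncomputable def edgeInt {E : Type*} [NormedAddCommGroup E] [NormedSpace ℝ E] (K : Tri) (i : Fin 3)
    (g : Plane → E) : E :=
  ∫ s in (0 : ℝ)..1, g (AffineMap.lineMap (K i) (K (i + 1)) s)

lemma intervalIntegrable_edge {E : Type*} [NormedAddCommGroup E] (K : Tri) (i : Fin 3) {g : Plane → E}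
    (hg : ContinuousOn g (carrier K)) :
    IntervalIntegrable (fun s : ℝ => g (AffineMap.lineMap (K i) (K (i + 1)) s)) volume 0 1 := by
  have h1 : Continuous fun s : ℝ => (AffineMap.lineMap (K i) (K (i + 1)) s : Plane) :=
    AffineMap.lineMap_continuous
  refine ContinuousOn.intervalIntegrable (hg.comp h1.continuousOn ?_)
  intro s hs
  rw [uIcc_of_le zero_le_one] at hs
  exact lineMap_mem K _ _ hs

section

variable {E : Type*} [NormedAddCommGroup E] [NormedSpace ℝ E]

lemma integral_flip (g : ℝ → E) : ∫ s in (0 : ℝ)..1, g (1 - s) = ∫ s in (0 : ℝ)..1, g s := by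
  simp

lemma edgeInt_zero (K : Tri) (g : Plane → E) :
    edgeInt K 0 g = ∫ s in (0 : ℝ)..1, g (K 0 + s • eA K) := by
  simp [edgeInt, AffineMap.lineMap_apply, eA, add_comm]

lemma edgeInt_one (K : Tri) (g : Plane → E) :
    edgeInt K 1 g = ∫ s in (0 : ℝ)..1, g (K 0 + (1 - s) • eA K + s • eB K) := by
  unfold edgeInt
  congr 1
  ext s
  congr 1
  rw [show (1 : Fin 3) + 1 = 2 from rfl, AffineMap.lineMap_apply, eA, eB, vsub_eq_sub, vadd_eq_add]
  module

lemma edgeInt_two (K : Tri) (g : Plane → E) :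
    edgeInt K 2 g = ∫ s in (0 : ℝ)..1, g (K 0 + s • eB K) := by
  rw [← integral_flip]
  unfold edgeInt
  congr 1
  ext s
  congr 1
  rw [show (2 : Fin 3) + 1 = 0 from rfl, AffineMap.lineMap_apply, eB, vsub_eq_sub, vadd_eq_add]
  module

lemma integral_fderiv_line [CompleteSpace E] {g : Plane → E} (hg : ContDiff ℝ 1 g)
    (p v : Plane) (c : ℝ) :
    ∫ s in (0 : ℝ)..c, fderiv ℝ g (p + s • v) v = g (p + c • v) - g p := by
  have hd : ∀ s : ℝ, HasDerivAt (fun s : ℝ => g (p + s • v)) (fderiv ℝ g (p + s • v) v) s := by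
    intro s
    have h1 : HasDerivAt (fun s : ℝ => p + s • v) v s := by
      simpa using ((hasDerivAt_id s).smul_const v).const_add p
    exact ((hg.differentiable one_ne_zero (p + s • v)).hasFDerivAt).comp_hasDerivAt s h1
  have hc : Continuous fun s : ℝ => fderiv ℝ g (p + s • v) v :=
    ((hg.continuous_fderiv one_ne_zero).comp (by fun_prop)).clm_apply continuous_const
  rw [intervalIntegral.integral_eq_sub_of_hasDerivAt (fun s _ => hd s) (hc.intervalIntegrable _ _)]
  simp

lemma continuous_fderiv_apply {g : Plane → E} (hg : ContDiff ℝ 1 g) (v : Plane) :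
    Continuous fun x => fderiv ℝ g x v :=
  (hg.continuous_fderiv one_ne_zero).clm_apply continuous_const

/-- On each segment parallel to `eA K` the fundamental theorem of calculus leaves the values at its
endpoints, which lie on the edges 1 and 2. -/
lemma integral_fderiv_eA [CompleteSpace E] (K : Tri) {g : Plane → E} (hg : ContDiff ℝ 1 g) :
    ∫ x in carrier K, fderiv ℝ g x (eA K) = |det K| • (edgeInt K 1 g - edgeInt K 2 g) := by
  rw [integral_carrier_swap K (continuous_fderiv_apply hg _).continuousOn, edgeInt_one,
    edgeInt_two, ← intervalIntegral.integral_sub]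
  · congr 2
    ext r
    have h := integral_fderiv_line hg (K 0 + r • eB K) (eA K) (1 - r)
    simp only [add_right_comm _ (r • eB K)] at h
    exact h
  all_goals
    exact Continuous.intervalIntegrable (hg.continuous.comp (by fun_prop)) _ _

lemma integral_fderiv_eB [CompleteSpace E] (K : Tri) {g : Plane → E} (hg : ContDiff ℝ 1 g) :
    ∫ x in carrier K, fderiv ℝ g x (eB K) = |det K| • (edgeInt K 1 g - edgeInt K 0 g) := by
  rw [integral_carrier K (continuous_fderiv_apply hg _).continuousOn, edgeInt_one,
    ← integral_flip (fun s => g (K 0 + (1 - s) • eA K + s • eB K)),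
    edgeInt_zero, ← intervalIntegral.integral_sub]
  · congr 2
    ext r
    simpa using integral_fderiv_line hg (K 0 + r • eA K) (eB K) (1 - r)
  all_goals
    exact Continuous.intervalIntegrable (hg.continuous.comp (by fun_prop)) _ _

/-- Cramer's rule splits the coordinate direction into the two edge directions, for which the
integrals are known. -/
lemma integral_fderiv_single [CompleteSpace E] (K : Tri) {g : Plane → E} (hg : ContDiff ℝ 1 g)
    (k : Fin 2) :
    ∫ x in carrier K, fderiv ℝ g x (EuclideanSpace.single k 1) =
      ∑ i, edgeNormal K i k • edgeInt K i g := by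
  set v : Plane := EuclideanSpace.single k 1 with hv
  have hint : ∀ w : Plane, IntegrableOn (fun x => fderiv ℝ g x w) (carrier K) := fun w =>
    (continuous_fderiv_apply hg w).continuousOn.integrableOn_compact (isCompact_carrier K)
  have h1 : det K • ∫ x in carrier K, fderiv ℝ g x v =
      det K • ∑ i, edgeNormal K i k • edgeInt K i g := by
    rw [← integral_smul]
    simp only [← map_smul, det_smul_eq K v]
    simp only [map_add, map_smul]
    rw [integral_add (((hint _).integrable).fun_smul _) (((hint _).integrable).fun_smul _),
      integral_smul, integral_smul, integral_fderiv_eA K hg, integral_fderiv_eB K hg, Fin.sum_univ_three]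
    -- The sign relating `|det K|` to `det K` is the one that makes the edge normals point outward,
    -- whatever the order of the vertices.
    have hs : |det K| = det K * orient K := by
      rw [orient_eq]
      rcases (det_ne_zero K).lt_or_gt with h | h
      · rw [Real.sign_of_neg h, abs_of_neg h]; ring
      · rw [Real.sign_of_pos h, abs_of_pos h]; ring
    rw [hs]
    have e0 : edgeNormal K 0 k = - (orient K * cross (eA K) v) := by
      fin_cases k <;> simp [edgeNormal, cross, eA, hv] <;> ring
    have e1 : edgeNormal K 1 k = orient K * (cross v (eB K) + cross (eA K) v) := by
      fin_cases k <;> simp [edgeNormal, cross, eA, eB, hv]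
    have e2 : edgeNormal K 2 k = - (orient K * cross v (eB K)) := by
      fin_cases k <;> simp [edgeNormal, cross, eB, hv] <;> ring
    rw [e0, e1, e2]
    module
  exact smul_right_injective E (det_ne_zero K) h1

end

variable {m : ℕ}

lemma boundaryFlux_eq_sum_edgeInt (K : Tri) {G : Fin 2 → Plane → State m}
    (hG : ∀ k, ContinuousOn (G k) (carrier K)) :
    boundaryFlux K (fun _ => 1) G = ∑ i, ∑ k, edgeNormal K i k • edgeInt K i (G k) := by
  unfold boundaryFlux edgeInt
  refine Finset.sum_congr rfl fun i _ => ?_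
  simp only [one_smul]
  rw [intervalIntegral.integral_finsetSum]
  · simp only [intervalIntegral.integral_smul]
  · intro k _
    exact (intervalIntegrable_edge K i (hG k)).continuousOn_smul continuousOn_const

lemma boundaryFlux_smul (K : Tri) (w : Plane → ℝ) (G : Fin 2 → Plane → State m) :
    boundaryFlux K w G = boundaryFlux K (fun _ => 1) (fun k x => w x • G k x) := by
  unfold boundaryFlux
  simp only [one_smul, Finset.smul_sum]
  simp only [smul_comm (w _)]

/-- The divergence theorem on a triangle. -/
lemma boundaryFlux_eq_integral_div (K : Tri) {G : Fin 2 → Plane → State m}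
    (hG : ∀ k, ContDiff ℝ 1 (G k)) :
    boundaryFlux K (fun _ => 1) G =
      ∫ x in carrier K, ∑ k, fderiv ℝ (G k) x (EuclideanSpace.single k 1) := by
  rw [boundaryFlux_eq_sum_edgeInt K fun k => (hG k).continuous.continuousOn, integral_finsetSum,
    Finset.sum_comm]
  · simp only [integral_fderiv_single K (hG _)]
  · intro k _
    exact (continuous_fderiv_apply (hG k) _).continuousOn.integrableOn_compact (isCompact_carrier K)

/-! ### Area, diameter and the gradients of the barycentric coordinates -/

lemma area_eq (K : Tri) : area K = |det K| / 2 := by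
  have h := integral_carrier K (F := fun _ => (1 : ℝ)) continuousOn_const
  have h1 : ∫ x in carrier K, (1 : ℝ) = area K := by simp [area]
  rw [← h1, h]
  have : ∫ s in (0 : ℝ)..1, ∫ r in (0 : ℝ)..(1 - s), (1 : ℝ) = 1 / 2 := by
    simp only [intervalIntegral.integral_const, smul_eq_mul, mul_one, sub_zero]
    rw [intervalIntegral.integral_sub (by simp) (by simp), integral_id]
    simp
    norm_num
  rw [this]
  simp [div_eq_mul_inv]

lemma area_pos (K : Tri) : 0 < area K := by
  rw [area_eq]
  have := abs_pos.2 (det_ne_zero K)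
  positivity

/-- The diameter of a triangle. -/
noncomputable def hK (K : Tri) : ℝ := Metric.diam (carrier K)

lemma dist_le_hK (K : Tri) {x y : Plane} (hx : x ∈ carrier K) (hy : y ∈ carrier K) :
    ‖x - y‖ ≤ hK K := by
  rw [← dist_eq_norm]
  exact Metric.dist_le_diam_of_mem (isCompact_carrier K).isBounded hx hy

lemma hK_pos (K : Tri) : 0 < hK K := by
  refine lt_of_lt_of_le (norm_pos_iff.2 ?_) (dist_le_hK K (vertex_mem K 1) (vertex_mem K 0))
  intro h
  apply det_ne_zero K
  simp [det, eA, h, cross]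

lemma abs_apply_le_norm (v : Plane) (i : Fin 2) : |v i| ≤ ‖v‖ := by
  simpa using PiLp.norm_apply_le v i

lemma abs_cross_single_le (k : Fin 2) (b : Plane) :
    |cross (EuclideanSpace.single k 1) b| ≤ ‖b‖ := by
  fin_cases k <;> simp [cross, abs_apply_le_norm]

lemma cross_swap (a b : Plane) : cross a b = - cross b a := by unfold cross; ring

/-- Barycentric coordinates change by at most one along an edge, so Cramer's rule bounds `|det K| =
2 |K|` times their partial derivatives by `2 h_K`. -/
lemma abs_linear_single_le (K : Tri) (i : Fin 3) (k : Fin 2) :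
    |(K.coord i).linear (EuclideanSpace.single k 1)| ≤ hK K / area K := by
  set v : Plane := EuclideanSpace.single k 1 with hv
  have h := congrArg (K.coord i).linear (det_smul_eq K v)
  rw [map_smul, map_add, map_smul, map_smul] at h
  have h1 : |cross v (eB K)| ≤ hK K :=
    (abs_cross_single_le k _).trans (dist_le_hK K (vertex_mem K 2) (vertex_mem K 0))
  have h2 : |cross (eA K) v| ≤ hK K := by
    rw [cross_swap, abs_neg]
    exact (abs_cross_single_le k _).trans (dist_le_hK K (vertex_mem K 1) (vertex_mem K 0))
  have hle : ∀ j l : Fin 3, |(K.coord i).linear (K j - K l)| ≤ 1 := by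
    intro j l
    rw [linear_edge]
    split_ifs <;> simp
  have h3 : |det K| * |(K.coord i).linear v| ≤ hK K + hK K := by
    rw [← abs_mul, ← smul_eq_mul, h]
    refine (abs_add_le _ _).trans (add_le_add ?_ ?_)
    · rw [smul_eq_mul, abs_mul]
      exact (mul_le_mul h1 (hle 1 0) (abs_nonneg _) (hK_pos K).le).trans_eq (mul_one _)
    · rw [smul_eq_mul, abs_mul]
      exact (mul_le_mul h2 (hle 2 0) (abs_nonneg _) (hK_pos K).le).trans_eq (mul_one _)
  rw [le_div_iff₀ (area_pos K), area_eq]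
  linarith

/-! ### Basis functions, their means and the mass matrix -/

/-- The basis functions in terms of the barycentric coordinates. -/
noncomputable def refShape : LocalDof → (Fin 3 → ℝ) → ℝ
  | Sum.inl (Sum.inl i) => fun c => c i * (2 * c i - 1)
  | Sum.inl (Sum.inr i) => fun c => 4 * c i * c (i + 1) - 60 * (c 0 * c 1 * c 2) / 3
  | Sum.inr _ => fun c => 60 * (c 0 * c 1 * c 2)

lemma shape_eq (K : Tri) (l : LocalDof) (x : Plane) :
    shape K l x = refShape l fun i => K.coord i x := by
  rcases l with (i | i) | i <;> simp [shape, refShape, bubble, Fin.prod_univ_three]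

lemma contDiff_refShape (l : LocalDof) : ContDiff ℝ 1 (refShape l) := by
  rcases l with (i | i) | i <;> simp only [refShape] <;> fun_prop

/-- The mean value over a triangle of a function of the barycentric coordinates. -/
noncomputable def refInt (P : (Fin 3 → ℝ) → ℝ) : ℝ :=
  2 * ∫ s in (0 : ℝ)..1, ∫ r in (0 : ℝ)..(1 - s), P ![1 - s - r, s, r]

lemma continuous_coord (K : Tri) (i : Fin 3) : Continuous (K.coord i) :=
  (K.coord i).continuous_of_finiteDimensional

lemma integral_comp_coord (K : Tri) {P : (Fin 3 → ℝ) → ℝ} (hP : Continuous P) :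
    ∫ x in carrier K, P (fun i => K.coord i x) = area K * refInt P := by
  rw [integral_carrier K]
  · have : ∀ s r : ℝ, (fun i => K.coord i (K 0 + s • eA K + r • eB K)) = ![1 - s - r, s, r] :=
      fun s r => funext fun i => coord_param K s r i
    simp only [this]
    rw [area_eq, refInt, smul_eq_mul]
    ring
  · exact (hP.comp (continuous_pi fun i => continuous_coord K i)).continuousOn

lemma integral_quartic (a b c d e x : ℝ) :
    ∫ r in (0 : ℝ)..x, (a + b * r + c * r ^ 2 + d * r ^ 3 + e * r ^ 4) =
      a * x + b * x ^ 2 / 2 + c * x ^ 3 / 3 + d * x ^ 4 / 4 + e * x ^ 5 / 5 := by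
  have h : ∀ r : ℝ, HasDerivAt (fun x : ℝ =>
      a * x + b * x ^ 2 / 2 + c * x ^ 3 / 3 + d * x ^ 4 / 4 + e * x ^ 5 / 5)
      (a + b * r + c * r ^ 2 + d * r ^ 3 + e * r ^ 4) r := by
    intro r
    have h1 := (hasDerivAt_id r).const_mul a
    have h2 := ((hasDerivAt_pow 2 r).const_mul b).div_const 2
    have h3 := ((hasDerivAt_pow 3 r).const_mul c).div_const 3
    have h4 := ((hasDerivAt_pow 4 r).const_mul d).div_const 4
    have h5 := ((hasDerivAt_pow 5 r).const_mul e).div_const 5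
    convert! (((h1.add h2).add h3).add h4).add h5 using 1
    push_cast
    ring
  rw [intervalIntegral.integral_eq_sub_of_hasDerivAt (fun r _ => h r)]
  · simp
  · exact Continuous.intervalIntegrable (by fun_prop) _ _

/-- Evaluation of `refInt` on a quadratic polynomial in the second barycentric coordinate whose
coefficients are functions of the first one. -/
lemma refInt_eq {P : (Fin 3 → ℝ) → ℝ} {p q w : ℝ → ℝ} {a b c d e v : ℝ}
    (h : ∀ s r, P ![1 - s - r, s, r] = p s + q s * r + w s * r ^ 2)
    (h2 : ∀ s, p s * (1 - s) + q s * (1 - s) ^ 2 / 2 + w s * (1 - s) ^ 3 / 3 =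
      a + b * s + c * s ^ 2 + d * s ^ 3 + e * s ^ 4)
    (hv : 2 * (a + b / 2 + c / 3 + d / 4 + e / 5) = v) : refInt P = v := by
  have hin : ∀ s : ℝ, ∫ r in (0 : ℝ)..(1 - s), P ![1 - s - r, s, r] =
      a + b * s + c * s ^ 2 + d * s ^ 3 + e * s ^ 4 := by
    intro s
    rw [← h2]
    have := integral_quartic (p s) (q s) (w s) 0 0 (1 - s)
    simp only [zero_mul, add_zero, zero_div] at this
    rw [← this]
    simp only [h]
  rw [refInt]
  simp only [hin]
  rw [integral_quartic, ← hv]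
  ring

lemma refInt_bubble : refInt (refShape (Sum.inr ())) = 1 :=
  refInt_eq (p := fun _ => 0) (q := fun s => 60 * s * (1 - s)) (w := fun s => - 60 * s)
    (a := 0) (b := 10) (c := -30) (d := 30) (e := -10)
    (fun s r => by simp [refShape]; ring) (fun s => by ring) (by norm_num)

/-- Subtracting a third of the bubble gives the midpoint functions mean zero, and the vertex
functions have it already. Hence the bubble coefficient alone carries the mean. -/
lemma refInt_shape (j : LocalNode) : refInt (refShape (Sum.inl j)) = 0 := by
  rcases j with i | i
  · fin_cases i
    · exact refInt_eq (p := fun s => 1 - 3 * s + 2 * s ^ 2) (q := fun s => - 3 + 4 * s)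
        (w := fun _ => 2)
        (a := 1 / 6) (b := -1) (c := 3 / 2) (d := - 2 / 3) (e := 0)
        (fun s r => by simp [refShape]; ring) (fun s => by ring) (by norm_num)
    · exact refInt_eq (p := fun s => s * (2 * s - 1)) (q := fun s => 0) (w := fun _ => 0)
        (a := 0) (b := -1) (c := 3) (d := - 2) (e := 0)
        (fun s r => by simp [refShape]) (fun s => by ring) (by norm_num)
    · exact refInt_eq (p := fun s => 0) (q := fun s => -1) (w := fun _ => 2)
        (a := 1 / 6) (b := -1) (c := 3 / 2) (d := - 2 / 3) (e := 0)
        (fun s r => by simp [refShape]; ring) (fun s => by ring) (by norm_num)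
  · fin_cases i
    · exact refInt_eq (p := fun s => 4 * s * (1 - s)) (q := fun s => - 4 * s - 20 * s * (1 - s))
        (w := fun s => 20 * s)
        (a := 0) (b := - 4 / 3) (c := 6) (d := - 8) (e := 10 / 3)
        (fun s r => by simp [refShape]; ring) (fun s => by ring) (by norm_num)
    · exact refInt_eq (p := fun s => 0) (q := fun s => 4 * s - 20 * s * (1 - s))
        (w := fun s => 20 * s)
        (a := 0) (b := - 4 / 3) (c := 6) (d := - 8) (e := 10 / 3)
        (fun s r => by simp [refShape]; ring) (fun s => by ring) (by norm_num)
    · exact refInt_eq (p := fun s => 0) (q := fun s => 4 * (1 - s) - 20 * s * (1 - s))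
        (w := fun s => - 4 + 20 * s)
        (a := 2 / 3) (b := - 16 / 3) (c := 12) (d := - 32 / 3) (e := 10 / 3)
        (fun s r => by simp [refShape]; ring) (fun s => by ring) (by norm_num)

lemma integral_bubble (K : Tri) : ∫ x in carrier K, shape K (Sum.inr ()) x = area K := by
  simp only [shape_eq]
  rw [integral_comp_coord K (contDiff_refShape _).continuous, refInt_bubble, mul_one]

lemma integral_shape (K : Tri) (j : LocalNode) :
    ∫ x in carrier K, shape K (Sum.inl j) x = 0 := by
  simp only [shape_eq]
  rw [integral_comp_coord K (contDiff_refShape _).continuous, refInt_shape, mul_zero]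

/-- The mass matrix of a triangle of area one. -/
noncomputable def refMass : Matrix LocalDof LocalDof ℝ :=
  Matrix.of fun i j => refInt fun c => refShape i c * refShape j c

lemma massMatrix_eq (K : Tri) : massMatrix K = area K • refMass := by
  ext i j
  simp only [massMatrix, refMass, Matrix.of_apply, Matrix.smul_apply, smul_eq_mul, shape_eq]
  rw [integral_comp_coord K (P := fun c => refShape i c * refShape j c)
    ((contDiff_refShape i).continuous.mul (contDiff_refShape j).continuous)]

lemma continuous_shape (K : Tri) (l : LocalDof) : Continuous (shape K l) := by
  have : shape K l = fun x => refShape l fun i => K.coord i x := funext (shape_eq K l)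
  rw [this]
  exact (contDiff_refShape l).continuous.comp (continuous_pi fun i => continuous_coord K i)

lemma contDiff_coord (K : Tri) (i : Fin 3) : ContDiff ℝ 1 (K.coord i) := by
  have : (K.coord i : Plane → ℝ) =
      fun x => (LinearMap.toContinuousLinearMap (K.coord i).linear) x + K.coord i 0 := by
    ext x
    have := coord_add K i 0 x
    rw [zero_add] at this
    rw [this, add_comm]
    rfl
  rw [this]
  exact (ContinuousLinearMap.contDiff _).add contDiff_const

lemma contDiff_shape (K : Tri) (l : LocalDof) : ContDiff ℝ 1 (shape K l) := by
  have : shape K l = fun x => refShape l fun i => K.coord i x := funext (shape_eq K l)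
  rw [this]
  exact (contDiff_refShape l).comp (contDiff_pi.2 fun i => contDiff_coord K i)

lemma shape_node (K : Tri) (l : LocalDof) (j : LocalNode) :
    shape K l (node K j) = if l = Sum.inl j then 1 else 0 := by
  have hmid : ∀ i n : Fin 3, K.coord n (midpoint ℝ (K i) (K (i + 1))) =
      ((if n = i then 1 else 0) + if n = i + 1 then 1 else 0) / 2 := by
    intro i n
    have h := (K.coord n).map_midpoint (K i) (K (i + 1))
    rw [h, midpoint_eq_smul_add, K.coord_apply, K.coord_apply, smul_eq_mul]
    simp
    ring
  rw [shape_eq]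
  rcases j with j | j
  · simp only [node, K.coord_apply]
    rcases l with (i | i) | i
    · fin_cases i <;> fin_cases j <;> simp [refShape] <;> norm_num
    · fin_cases i <;> fin_cases j <;> simp [refShape]
    · fin_cases j <;> simp [refShape]
  · simp only [node, hmid]
    rcases l with (i | i) | i
    · fin_cases i <;> fin_cases j <;> simp [refShape] 
    · fin_cases i <;> fin_cases j <;> simp [refShape] <;> norm_num
    · fin_cases j <;> simp [refShape]

/-- Needed to pass from almost everywhere to everywhere for continuous functions on the closed
triangle. -/
lemma carrier_subset_closure_interior (K : Tri) : carrier K ⊆ closure (interior (carrier K)) := by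
  rw [(convex_carrier K).closure_interior_eq_closure_of_nonempty_interior
    ⟨_, K.centroid_mem_interior_convexHull⟩]
  exact subset_closure

/-- The basis functions are linearly independent on the triangle. -/
lemma eq_zero_of_sum_shape_eq_zero (K : Tri) {c : LocalDof → ℝ}
    (h : ∀ x ∈ carrier K, ∑ l, c l * shape K l x = 0) : c = 0 := by
  have hn : ∀ j : LocalNode, c (Sum.inl j) = 0 := by
    -- Evaluation at the nodes isolates the six point coefficients; the mean then isolates the
    -- bubble coefficient.
    intro j
    simpa [shape_node] using h _ (node_mem K j)
  have hb : c (Sum.inr ()) * area K = 0 := by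
    rw [← integral_bubble K, ← integral_const_mul]
    refine setIntegral_eq_zero_of_forall_eq_zero fun x hx => ?_
    have := h x hx
    rw [Fintype.sum_sum_type] at this
    simpa [hn] using this
  have hb' := (mul_eq_zero.1 hb).resolve_right (area_pos K).ne'
  ext l
  rcases l with j | u
  · exact hn j
  · exact hb'

lemma integrableOn_carrier {E : Type*} [NormedAddCommGroup E] (K : Tri) {F : Plane → E}
    (hF : ContinuousOn F (carrier K)) : IntegrableOn F (carrier K) :=
  hF.integrableOn_compact (isCompact_carrier K)

/-- It is a Gram matrix: a kernel vector yields a combination `g` of the basis with `∫ g² = 0`, so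
`g` vanishes on the triangle and independence applies. -/
lemma det_massMatrix_ne_zero (K : Tri) : (massMatrix K).det ≠ 0 := by
  intro h
  obtain ⟨c, hc, hM⟩ := Matrix.exists_mulVec_eq_zero_iff.2 h
  apply hc
  apply eq_zero_of_sum_shape_eq_zero K
  set g : Plane → ℝ := fun x => ∑ l, c l * shape K l x with hg
  have hgc : Continuous g :=
    continuous_finsetSum _ fun l _ => continuous_const.mul (continuous_shape K l)
  have hint : ∫ x in carrier K, g x * g x = 0 := by
    have h1 : ∀ i, ∫ x in carrier K, shape K i x * g x = 0 := by
      intro i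
      have := congrFun hM i
      rw [Matrix.mulVec, dotProduct] at this
      simp only [massMatrix, Matrix.of_apply, ← integral_mul_const, Pi.zero_apply] at this
      rw [← this, ← integral_finsetSum]
      · simp only [hg, Finset.mul_sum]
        congr 1; ext x
        refine Finset.sum_congr rfl fun l _ => by ring
      · intro l _
        exact integrableOn_carrier K (((continuous_shape K i).mul (continuous_shape K l)).mul
          continuous_const).continuousOn
    have h2 : ∀ x, g x * g x = ∑ i, c i * (shape K i x * g x) := by
      intro x
      conv_lhs => rw [hg]
      simp only [Finset.sum_mul, mul_assoc]
      rfl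
    simp only [h2]
    rw [integral_finsetSum]
    · simp only [integral_const_mul, h1, mul_zero, Finset.sum_const_zero]
    · intro l _
      exact integrableOn_carrier K
        (continuous_const.mul ((continuous_shape K l).mul hgc)).continuousOn
  have hae : (fun x => g x * g x) =ᵐ[volume.restrict (carrier K)] 0 :=
    (integral_eq_zero_iff_of_nonneg (fun x => mul_self_nonneg _)
      (integrableOn_carrier K (hgc.mul hgc).continuousOn)).1 hint
  have heq := MeasureTheory.Measure.eqOn_of_ae_eq hae (hgc.mul hgc).continuousOn
    continuousOn_const (carrier_subset_closure_interior K)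
  intro x hx
  exact mul_self_eq_zero.1 (heq hx)

/-- The mass matrix depends on the triangle only through its area, so one fixed matrix bounds all
the inverses. -/
lemma inv_massMatrix (K : Tri) : (massMatrix K)⁻¹ = (area K)⁻¹ • refMass⁻¹ := by
  have h := det_massMatrix_ne_zero K
  have hr : IsUnit refMass.det := by
    rw [isUnit_iff_ne_zero]
    rw [massMatrix_eq, Matrix.det_smul] at h
    exact right_ne_zero_of_mul h
  rw [massMatrix_eq]
  apply Matrix.inv_eq_right_inv
  rw [Matrix.smul_mul, Matrix.mul_smul, Matrix.mul_nonsing_inv _ hr, smul_smul,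
    mul_inv_cancel₀ (area_pos K).ne', one_smul]

/-- A bound for the entries of the inverse mass matrix of a triangle of area one. -/
noncomputable def massBound : ℝ := ∑ i, ∑ j, |refMass⁻¹ i j|

lemma massBound_nonneg : 0 ≤ massBound :=
  Finset.sum_nonneg fun _ _ => Finset.sum_nonneg fun _ _ => abs_nonneg _

lemma abs_inv_massMatrix_le (K : Tri) (i l : LocalDof) :
    |(massMatrix K)⁻¹ i l| ≤ massBound / area K := by
  rw [inv_massMatrix, Matrix.smul_apply, smul_eq_mul, abs_mul, abs_inv, abs_of_pos (area_pos K),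
    div_eq_inv_mul]
  refine mul_le_mul_of_nonneg_left ?_ (inv_nonneg.2 (area_pos K).le)
  refine (Finset.single_le_sum (f := fun j => |refMass⁻¹ i j|) (fun j _ => abs_nonneg _)
    (Finset.mem_univ l)).trans ?_
  exact Finset.single_le_sum (f := fun i => ∑ j, |refMass⁻¹ i j|)
    (fun j _ => Finset.sum_nonneg fun _ _ => abs_nonneg _) (Finset.mem_univ i)

/-! ### The `L²` projection, quadratic polynomials and interpolation -/

section

variable {E : Type*} [NormedAddCommGroup E] [NormedSpace ℝ E]

/-- The `L²` projection reproduces the functions spanned by the local basis. -/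
lemma projection_eq [CompleteSpace E] (K : Tri) (c : LocalDof → E) (j : LocalDof) :
    ∑ l, (massMatrix K)⁻¹ j l • ∫ x in carrier K, shape K l x • ∑ i, shape K i x • c i = c j := by
  have h1 : ∀ l, ∫ x in carrier K, shape K l x • ∑ i, shape K i x • c i =
      ∑ i, massMatrix K l i • c i := by
    intro l
    simp only [Finset.smul_sum, smul_smul]
    rw [integral_finsetSum]
    · simp only [integral_smul_const]; rfl
    · intro i _
      exact integrableOn_carrier K (((continuous_shape K l).mul (continuous_shape K i)).smul
          continuous_const).continuousOn
  simp only [h1]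
  simp only [Finset.smul_sum, smul_smul]
  rw [Finset.sum_comm]
  simp only [← Finset.sum_smul]
  have h2 : ∀ i, ∑ l, (massMatrix K)⁻¹ j l * massMatrix K l i = (1 : Matrix _ _ ℝ) j i := by
    intro i
    rw [← Matrix.nonsing_inv_mul _ (isUnit_iff_ne_zero.2 (det_massMatrix_ne_zero K))]
    rfl
  simp [h2, Matrix.one_apply]

/-- Polynomials of degree at most two, written around a point. -/
def IsQuadratic (q : Plane → E) : Prop :=
  ∃ (a : Plane) (c : E) (L : Plane →ₗ[ℝ] E) (B : Plane →ₗ[ℝ] Plane →ₗ[ℝ] E),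
    ∀ x, q x = c + L (x - a) + B (x - a) (x - a)

lemma IsQuadratic.continuous {q : Plane → E} (hq : IsQuadratic q) : Continuous q := by
  obtain ⟨a, c, L, B, h⟩ := hq
  have : q = fun x => c + L (x - a) + B (x - a) (x - a) := funext h
  rw [this]
  have hL := L.continuous_of_finiteDimensional
  have hB : Continuous fun p : Plane × Plane => B p.1 p.2 := by
    let B' : Plane →ₗ[ℝ] Plane →L[ℝ] E :=
      (LinearMap.toContinuousLinearMap : (Plane →ₗ[ℝ] E) ≃ₗ[ℝ] _).toLinearMap ∘ₗ B
    have h1 := B'.continuous_of_finiteDimensional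
    exact (h1.comp continuous_fst).clm_apply continuous_snd
  have h2 : Continuous fun x : Plane => x - a := by fun_prop
  exact (continuous_const.add (hL.comp h2)).add (hB.comp (h2.prodMk h2))

/-- This is quadratic Lagrange interpolation: the bubble term compensates exactly for the `bubble /
3` removed from each midpoint function. -/
lemma IsQuadratic.eq_sum {q : Plane → E} (hq : IsQuadratic q) (K : Tri) (x : Plane) :
    q x = ∑ j : LocalNode, shape K (Sum.inl j) x • q (node K j)
      + shape K (Sum.inr ()) x • (3⁻¹ : ℝ) • ∑ i, q (node K (Sum.inr i)) := by
  obtain ⟨a, c, L, B, h⟩ := hq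
  have hx : x - a = (K 0 - a) + K.coord 1 x • ((K 1 - a) - (K 0 - a))
      + K.coord 2 x • ((K 2 - a) - (K 0 - a)) := by
    nth_rewrite 1 [eq_of_coord K x]
    rw [eA, eB]
    module
  have hm : ∀ i, node K (Sum.inr i) - a =
      (2⁻¹ : ℝ) • (K i - a) + (2⁻¹ : ℝ) • (K (i + 1) - a) := by
    intro i
    rw [node, midpoint_eq_smul_add]
    simp only [invOf_eq_inv]
    module
  have hs := K.sum_coord_apply_eq_one x
  rw [Fin.sum_univ_three] at hs
  have h0 : K.coord 0 x = 1 - K.coord 1 x - K.coord 2 x := by linarith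
  rw [h, hx, Fintype.sum_sum_type, Fin.sum_univ_three, Fin.sum_univ_three, Fin.sum_univ_three]
  simp only [h, hm, shape_eq, refShape, h0]
  simp only [node, Fin.isValue, show (0 : Fin 3) + 1 = 1 from rfl,
    show (1 : Fin 3) + 1 = 2 from rfl, show (2 : Fin 3) + 1 = 0 from rfl, h0]
  generalize K 0 - a = y0
  generalize K 1 - a = y1
  generalize K 2 - a = y2
  simp only [map_add, map_sub, map_smul, LinearMap.add_apply, LinearMap.sub_apply,
    LinearMap.smul_apply]
  module

end

/-- The edge midpoint rule is exact on quadratics: in the Lagrange expansion every term but the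
bubble has mean zero. -/
lemma IsQuadratic.cellAverage_eq {q : Plane → State m} (hq : IsQuadratic q) (K : Tri) :
    cellAverage K q = (3⁻¹ : ℝ) • ∑ i, q (node K (Sum.inr i)) := by
  have hi : ∀ (l : LocalDof) (v : State m), IntegrableOn (fun x => shape K l x • v) (carrier K) :=
    fun l v => integrableOn_carrier K ((continuous_shape K l).smul continuous_const).continuousOn
  rw [cellAverage]
  have : ∫ x in carrier K, q x = ∫ x in carrier K,
      (∑ j : LocalNode, shape K (Sum.inl j) x • q (node K j)
      + shape K (Sum.inr ()) x • (3⁻¹ : ℝ) • ∑ i, q (node K (Sum.inr i))) := by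
    congr 1
    ext1 x
    exact hq.eq_sum K x
  rw [this, integral_add (integrable_finsetSum _ fun j _ => hi _ _) (hi _ _),
    integral_finsetSum _ fun j _ => hi _ _]
  simp only [integral_smul_const, integral_shape, integral_bubble, zero_smul,
    Finset.sum_const_zero, zero_add]
  rw [smul_smul, inv_mul_cancel₀ (area_pos K).ne', one_smul]

/-- The interpolation reproduces quadratic polynomials. -/
lemma IsQuadratic.interp_eq {q : Plane → State m} (hq : IsQuadratic q) (K : Tri) (x : Plane) :
    interp K q x = q x := by
  rw [interp, hq.cellAverage_eq, ← hq.eq_sum]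

/-- The mean value of the interpolant. -/
lemma cellAverage_interp (K : Tri) (v : Plane → State m) :
    cellAverage K (interp K v) = cellAverage K v := by
  have hi : ∀ (l : LocalDof) (v : State m), IntegrableOn (fun x => shape K l x • v) (carrier K) :=
    fun l v => integrableOn_carrier K ((continuous_shape K l).smul continuous_const).continuousOn
  conv_lhs => rw [cellAverage]
  simp only [interp]
  rw [integral_add (integrable_finsetSum _ fun j _ => hi _ _) (hi _ _),
    integral_finsetSum _ fun j _ => hi _ _]
  simp only [integral_smul_const, integral_shape, integral_bubble, zero_smul,
    Finset.sum_const_zero, zero_add]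
  rw [smul_smul, inv_mul_cancel₀ (area_pos K).ne', one_smul]

/-! ### Bounds for the basis functions, boundary fluxes and the interpolation error -/

lemma coord_mem_Icc (K : Tri) {x : Plane} (hx : x ∈ carrier K) (i : Fin 3) :
    K.coord i x ∈ Icc (0 : ℝ) 1 := by
  have h := (mem_carrier_iff K x).1 hx
  refine ⟨h i, ?_⟩
  rw [← K.sum_coord_apply_eq_one x]
  exact Finset.single_le_sum (f := fun i => K.coord i x) (fun j _ => h j) (Finset.mem_univ i)

lemma abs_refShape_le (l : LocalDof) {c : Fin 3 → ℝ} (hc : ∀ i, c i ∈ Icc (0 : ℝ) 1) :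
    |refShape l c| ≤ 60 := by
  have hb : 0 ≤ c 0 * c 1 * c 2 ∧ c 0 * c 1 * c 2 ≤ 1 := by
    have h0 := hc 0
    have h1 := hc 1
    have h2 := hc 2
    exact ⟨mul_nonneg (mul_nonneg h0.1 h1.1) h2.1,
      mul_le_one₀ (mul_le_one₀ h0.2 h1.1 h1.2) h2.1 h2.2⟩
  rcases l with (i | i) | i
  · have := hc i
    simp only [refShape]
    rw [abs_le]
    constructor <;> nlinarith [this.1, this.2]
  · have h1 := hc i
    have h2 := hc (i + 1)
    have h3 : 0 ≤ c i * c (i + 1) := mul_nonneg h1.1 h2.1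
    have h4 : c i * c (i + 1) ≤ 1 := mul_le_one₀ h1.2 h2.1 h2.2
    simp only [refShape, mul_assoc (4 : ℝ)]
    rw [abs_le]
    constructor <;> linarith [hb.1, hb.2]
  · simp only [refShape]
    rw [abs_le]
    constructor <;> linarith [hb.1, hb.2]

lemma abs_shape_le (K : Tri) (l : LocalDof) {x : Plane} (hx : x ∈ carrier K) :
    |shape K l x| ≤ 60 := by
  rw [shape_eq]
  exact abs_refShape_le l (coord_mem_Icc K hx)

lemma hasLineDeriv_coord (K : Tri) (i : Fin 3) (x v : Plane) :
    HasDerivAt (fun t : ℝ => K.coord i (x + t • v)) ((K.coord i).linear v) 0 := by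
  have : (fun t : ℝ => K.coord i (x + t • v)) =
      fun t => K.coord i x + t * (K.coord i).linear v := by
    ext t
    rw [coord_add, map_smul, smul_eq_mul]
  rw [this]
  simpa using ((hasDerivAt_id (0 : ℝ)).mul_const ((K.coord i).linear v)).const_add (K.coord i x)

/-- Differentiation along a line reduces this to the product rule in the barycentric coordinates.
The worst case is the bubble, with three terms of size 60. -/
lemma abs_fderiv_shape_le (K : Tri) (l : LocalDof) {x : Plane} (hx : x ∈ carrier K) (k : Fin 2) :
    |fderiv ℝ (shape K l) x (EuclideanSpace.single k 1)| ≤ 180 * (hK K / area K) := by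
  set v : Plane := EuclideanSpace.single k 1
  have hd : HasDerivAt (fun t : ℝ => shape K l (x + t • v)) (fderiv ℝ (shape K l) x v) 0 := by
    have h1 := ((contDiff_shape K l).differentiable one_ne_zero x).hasFDerivAt.hasLineDerivAt v
    exact h1
  set δ : Fin 3 → ℝ := fun i => (K.coord i).linear v with hδ
  set c : Fin 3 → ℝ := fun i => K.coord i x with hcdef
  have hc : ∀ i, c i ∈ Icc (0 : ℝ) 1 := coord_mem_Icc K hx
  have hD : ∀ i, |δ i| ≤ hK K / area K := fun i => abs_linear_single_le K i k
  have hD0 : 0 ≤ hK K / area K := (abs_nonneg _).trans (hD 0)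
  have hl : ∀ i, HasDerivAt (fun t : ℝ => K.coord i (x + t • v)) (δ i) 0 :=
    fun i => hasLineDeriv_coord K i x v
  have e0 : ∀ i, K.coord i (x + (0 : ℝ) • v) = c i := fun i => by simp [hcdef]
  have hmul : ∀ (a : ℝ) (i : Fin 3), |a| ≤ 1 → |a * δ i| ≤ hK K / area K := by
    intro a i ha
    rw [abs_mul]
    exact (mul_le_mul ha (hD i) (abs_nonneg _) zero_le_one).trans_eq (one_mul _)
  have hc1 : ∀ i, |c i| ≤ 1 := fun i => abs_le.2 ⟨by linarith [(hc i).1], (hc i).2⟩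
  have hcc : ∀ i j, |c i * c j| ≤ 1 := fun i j => by
    rw [abs_mul]; exact mul_le_one₀ (hc1 i) (abs_nonneg _) (hc1 j)
  have hB := (((hl 0).mul (hl 1)).mul (hl 2)).const_mul 60
  have b0 := abs_le.1 (hmul _ 0 (hcc 1 2))
  have b1 := abs_le.1 (hmul _ 1 (hcc 0 2))
  have b2 := abs_le.1 (hmul _ 2 (hcc 0 1))
  rcases l with (i | i) | i
  · have h := (hl i).mul (((hl i).const_mul 2).sub_const 1)
    have : fderiv ℝ (shape K (Sum.inl (Sum.inl i))) x v = 4 * (c i * δ i) - δ i := by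
      refine (hd.unique h).trans ?_
      simp only [e0]
      ring
    rw [this, abs_le]
    have h1 := abs_le.1 (hmul _ i (hc1 i))
    have h2 := abs_le.1 (hD i)
    constructor <;> linarith [h1.1, h1.2, h2.1, h2.2]
  · have h := (((hl i).const_mul 4).mul (hl (i + 1))).sub (hB.div_const 3)
    have : fderiv ℝ (shape K (Sum.inl (Sum.inr i))) x v =
        4 * (c (i + 1) * δ i) + 4 * (c i * δ (i + 1))
        - 20 * (c 1 * c 2 * δ 0 + c 0 * c 2 * δ 1 + c 0 * c 1 * δ 2) := by
      refine (hd.unique (h.congr_of_eventuallyEq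
        (Filter.Eventually.of_forall fun t => ?_))).trans ?_
      · simp [shape, bubble, Fin.prod_univ_three]
      · simp only [Pi.mul_apply, e0]
        ring
    rw [this, abs_le]
    have h1 := abs_le.1 (hmul _ i (hc1 (i + 1)))
    have h2 := abs_le.1 (hmul _ (i + 1) (hc1 i))
    constructor <;> linarith [h1.1, h1.2, h2.1, h2.2, b0.1, b0.2, b1.1, b1.2, b2.1, b2.2]
  · have : fderiv ℝ (shape K (Sum.inr i)) x v =
        60 * (c 1 * c 2 * δ 0 + c 0 * c 2 * δ 1 + c 0 * c 1 * δ 2) := by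
      refine (hd.unique (hB.congr_of_eventuallyEq
        (Filter.Eventually.of_forall fun t => ?_))).trans ?_
      · simp [shape, bubble, Fin.prod_univ_three]
      · simp only [Pi.mul_apply, e0]
        ring
    rw [this, abs_le]
    constructor <;> linarith [b0.1, b0.2, b1.1, b1.2, b2.1, b2.2]

lemma abs_edgeNormal_le (K : Tri) (i : Fin 3) (k : Fin 2) : |edgeNormal K i k| ≤ hK K := by
  have ho : |orient K| ≤ 1 := by
    rw [orient_eq]
    rcases Real.sign_apply_eq (det K) with h | h | h <;> simp [h]
  have h1 : ∀ n, |K (i + 1) n - K i n| ≤ hK K := fun n =>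
    (abs_apply_le_norm (K (i + 1) - K i) n).trans (dist_le_hK K (vertex_mem K _) (vertex_mem K _))
  have h2 : |edgeNormal K i k| ≤ |orient K| * hK K := by
    fin_cases k
    · simp only [edgeNormal]
      simp only [Fin.zero_eta, PiLp.smul_apply, smul_eq_mul, abs_mul]
      exact mul_le_mul_of_nonneg_left (by simpa using h1 1) (abs_nonneg _)
    · simp only [edgeNormal]
      simp only [Fin.mk_one, PiLp.smul_apply, smul_eq_mul, abs_mul]
      refine mul_le_mul_of_nonneg_left ?_ (abs_nonneg _)
      have := h1 0
      rw [abs_sub_comm] at this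
      simpa using this
  exact h2.trans ((mul_le_mul_of_nonneg_right ho (hK_pos K).le).trans_eq (one_mul _))

/-- The factor 6 counts three edges and two flux components. -/
lemma norm_boundaryFlux_le (K : Tri) {w : Plane → ℝ} {G : Fin 2 → Plane → State m} {ε : ℝ}
    (h : ∀ k, ∀ x ∈ carrier K, ‖w x • G k x‖ ≤ ε) : ‖boundaryFlux K w G‖ ≤ 6 * hK K * ε := by
  have h1 : ∀ i : Fin 3, ‖∫ s in (0 : ℝ)..1,
    w (AffineMap.lineMap (K i) (K (i + 1)) s) •
      ∑ k : Fin 2, edgeNormal K i k • G k (AffineMap.lineMap (K i) (K (i + 1)) s)‖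
      ≤ 2 * hK K * ε := by
    intro i
    refine (intervalIntegral.norm_integral_le_of_norm_le_const (C := 2 * hK K * ε) ?_).trans
      (by simp)
    intro s hs
    rw [uIoc_of_le zero_le_one] at hs
    have hx := lineMap_mem K i (i + 1) (Ioc_subset_Icc_self hs)
    rw [Finset.smul_sum]
    refine (norm_sum_le _ _).trans ?_
    have : ∀ k, ‖w (AffineMap.lineMap (K i) (K (i + 1)) s) •
        edgeNormal K i k • G k (AffineMap.lineMap (K i) (K (i + 1)) s)‖ ≤ hK K * ε := by
      intro k
      rw [smul_comm, norm_smul]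
      exact mul_le_mul (abs_edgeNormal_le K i k) (h k _ hx) (norm_nonneg _) (hK_pos K).le
    refine (Finset.sum_le_sum fun k _ => this k).trans_eq ?_
    simp
    ring
  refine (norm_sum_le _ _).trans ((Finset.sum_le_sum fun i _ => h1 i).trans_eq ?_)
  simp
  ring

lemma boundaryFlux_sub (K : Tri) {G H : Fin 2 → Plane → State m}
    (hG : ∀ k, ContinuousOn (G k) (carrier K)) (hH : ∀ k, ContinuousOn (H k) (carrier K)) :
    boundaryFlux K (fun _ => 1) (fun k x => G k x - H k x) =
      boundaryFlux K (fun _ => 1) G - boundaryFlux K (fun _ => 1) H := by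
  rw [boundaryFlux_eq_sum_edgeInt K hG, boundaryFlux_eq_sum_edgeInt K hH,
    boundaryFlux_eq_sum_edgeInt K (G := fun k x => G k x - H k x) fun k => (hG k).sub (hH k)]
  simp only [← Finset.sum_sub_distrib, ← smul_sub]
  refine Finset.sum_congr rfl fun i _ => Finset.sum_congr rfl fun k _ => ?_
  congr 1
  exact intervalIntegral.integral_sub (intervalIntegrable_edge K i (hG k))
    (intervalIntegrable_edge K i (hH k))

lemma continuous_interp (K : Tri) (v : Plane → State m) : Continuous (interp K v) := by
  unfold interp
  exact (continuous_finsetSum _ fun j _ => (continuous_shape K _).smul continuous_const).add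
    ((continuous_shape K _).smul continuous_const)

lemma norm_setIntegral_carrier_le {E : Type*} [NormedAddCommGroup E] [NormedSpace ℝ E] (K : Tri)
    {F : Plane → E} {ε : ℝ} (h : ∀ x ∈ carrier K, ‖F x‖ ≤ ε) :
    ‖∫ x in carrier K, F x‖ ≤ ε * area K :=
  norm_setIntegral_le_of_norm_le_const (isCompact_carrier K).measure_lt_top h

lemma norm_cellAverage_le (K : Tri) {v : Plane → State m} {ε : ℝ}
    (h : ∀ x ∈ carrier K, ‖v x‖ ≤ ε) : ‖cellAverage K v‖ ≤ ε := by
  rw [cellAverage, norm_smul, norm_inv, Real.norm_of_nonneg (area_pos K).le,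
    inv_mul_le_iff₀ (area_pos K), mul_comm]
  exact norm_setIntegral_carrier_le K h

/-- Seven degrees of freedom, each with a basis function bounded by 60. -/
lemma norm_interp_le (K : Tri) {v : Plane → State m} {ε : ℝ}
    (h : ∀ x ∈ carrier K, ‖v x‖ ≤ ε) {x : Plane} (hx : x ∈ carrier K) :
    ‖interp K v x‖ ≤ 420 * ε := by
  have hs : ∀ (l : LocalDof) (y : State m), ‖y‖ ≤ ε → ‖shape K l x • y‖ ≤ 60 * ε := by
    intro l y hy
    rw [norm_smul]
    exact mul_le_mul (abs_shape_le K l hx) hy (norm_nonneg _) (by norm_num)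
  have h1 : ‖∑ j : LocalNode, shape K (Sum.inl j) x • v (node K j)‖ ≤ 360 * ε := by
    refine (norm_sum_le _ _).trans ((Finset.sum_le_sum fun j _ =>
      hs _ _ (h _ (node_mem K j))).trans_eq ?_)
    simp
    ring
  have h2 := hs (Sum.inr ()) _ (norm_cellAverage_le K h)
  exact (norm_add_le _ _).trans (by linarith)

lemma interp_sub (K : Tri) {v w : Plane → State m} (hv : ContinuousOn v (carrier K))
    (hw : ContinuousOn w (carrier K)) (x : Plane) :
    interp K (fun y => v y - w y) x = interp K v x - interp K w x := by
  unfold interp cellAverage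
  rw [integral_sub (integrableOn_carrier K hv) (integrableOn_carrier K hw)]
  simp only [smul_sub, Finset.sum_sub_distrib]
  abel

/-- The interpolation error is controlled by the distance to quadratic polynomials. -/
lemma norm_interp_sub_le (K : Tri) {v q : Plane → State m} (hv : ContinuousOn v (carrier K))
    (hq : IsQuadratic q) {ε : ℝ} (h : ∀ x ∈ carrier K, ‖v x - q x‖ ≤ ε) {x : Plane}
    (hx : x ∈ carrier K) : ‖interp K v x - v x‖ ≤ 421 * ε := by
  have h1 := norm_interp_le K h hx
  rw [interp_sub K hv hq.continuous.continuousOn, hq.interp_eq] at h1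
  have h2 := h x hx
  calc ‖interp K v x - v x‖ = ‖(interp K v x - q x) - (v x - q x)‖ := by congr 1; abel
    _ ≤ _ := (norm_sub_le _ _).trans (by linarith)

/-! ### Loads and the consistency of the point residuals -/

/-- Volume and boundary terms both scale like `h_K`: gradients `180 h_K / |K|` in two directions,
integrated over area `|K|`, give 360, and the boundary gives `6 · 60`. -/
lemma norm_dgLoad_sub_le (K : Tri) {f : Fin 2 → State m → State m} {v w : Plane → State m} {ε : ℝ}
    (hv : ∀ k, ContinuousOn (fun x => f k (v x)) (carrier K))
    (hw : ∀ k, ContinuousOn (fun x => f k (w x)) (carrier K))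
    (h : ∀ k, ∀ x ∈ carrier K, ‖f k (v x) - f k (w x)‖ ≤ ε) (l : LocalDof) :
    ‖dgLoad K f v l - dgLoad K f w l‖ ≤ 720 * hK K * ε := by
  have hc : ∀ k : Fin 2, ContinuousOn
      (fun x => fderiv ℝ (shape K l) x (EuclideanSpace.single k 1)) (carrier K) := fun k =>
    (continuous_fderiv_apply (contDiff_shape K l) _).continuousOn
  have hi : ∀ {v : Plane → State m}, (∀ k, ContinuousOn (fun x => f k (v x)) (carrier K)) →
      IntegrableOn (fun x => ∑ k : Fin 2,
        fderiv ℝ (shape K l) x (EuclideanSpace.single k 1) • f k (v x)) (carrier K) := fun hv =>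
    integrableOn_carrier K (continuousOn_finsetSum _ fun k _ => (hc k).smul (hv k))
  have h1 : dgLoad K f v l - dgLoad K f w l =
      -(∫ x in carrier K, ∑ k : Fin 2,
        fderiv ℝ (shape K l) x (EuclideanSpace.single k 1) • (f k (v x) - f k (w x)))
      + boundaryFlux K (fun _ => 1) (fun k x => shape K l x • f k (v x) - shape K l x • f k (w x))
      := by
    rw [boundaryFlux_sub K (G := fun k x => shape K l x • f k (v x))
      (H := fun k x => shape K l x • f k (w x)) (fun k => (continuous_shape K l).continuousOn.smul (hv k))
      (fun k => (continuous_shape K l).continuousOn.smul (hw k)), ← boundaryFlux_smul,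
      ← boundaryFlux_smul, dgLoad, dgLoad]
    simp only [smul_sub, Finset.sum_sub_distrib]
    rw [integral_sub (hi hv) (hi hw)]
    abel
  have h2 : ‖∫ x in carrier K, ∑ k : Fin 2,
      fderiv ℝ (shape K l) x (EuclideanSpace.single k 1) • (f k (v x) - f k (w x))‖ ≤
      360 * hK K * ε := by
    have : 360 * hK K * ε = (2 * (180 * (hK K / area K) * ε)) * area K := by
      field_simp [(area_pos K).ne']
      ring
    rw [this]
    refine norm_setIntegral_carrier_le K fun x hx => ?_
    refine (norm_sum_le _ _).trans ?_
    rw [Fin.sum_univ_two, two_mul]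
    have hk : ∀ k : Fin 2, ‖fderiv ℝ (shape K l) x (EuclideanSpace.single k 1) •
        (f k (v x) - f k (w x))‖ ≤ 180 * (hK K / area K) * ε := by
      intro k
      rw [norm_smul]
      exact mul_le_mul (abs_fderiv_shape_le K l hx k) (h k x hx) (norm_nonneg _)
        ((abs_nonneg _).trans (abs_fderiv_shape_le K l hx k))
    exact add_le_add (hk 0) (hk 1)
  have h3 := norm_boundaryFlux_le K (w := fun _ => 1)
    (G := fun k x => shape K l x • f k (v x) - shape K l x • f k (w x)) (ε := 60 * ε) (by
      intro k x hx
      rw [one_smul, ← smul_sub, norm_smul]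
      exact mul_le_mul (abs_shape_le K l hx) (h k x hx) (norm_nonneg _) (by norm_num))
  rw [h1]
  refine (norm_add_le _ _).trans ?_
  rw [norm_neg]
  linarith

/-- Integration by parts in the load of a smooth flux. -/
lemma dgLoad_eq_integral (K : Tri) {f : Fin 2 → State m → State m} {v : Plane → State m}
    (hv : ∀ k, ContDiff ℝ 1 fun x => f k (v x)) (l : LocalDof) :
    dgLoad K f v l = ∫ x in carrier K, shape K l x •
      ∑ k, fderiv ℝ (fun y => f k (v y)) x (EuclideanSpace.single k 1) := by
  have hs := contDiff_shape K l
  rw [dgLoad, boundaryFlux_smul, boundaryFlux_eq_integral_div K (G := fun k x => shape K l x • f k (v x))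
      fun k => hs.smul (hv k),
    neg_add_eq_sub, ← integral_sub]
  · congr 1
    ext1 x
    rw [← Finset.sum_sub_distrib, Finset.smul_sum]
    refine Finset.sum_congr rfl fun k _ => ?_
    have h := ((hs.differentiable one_ne_zero x).hasFDerivAt.smul
      ((hv k).differentiable one_ne_zero x).hasFDerivAt).fderiv
    have h' : fderiv ℝ (fun x => shape K l x • f k (v x)) x = _ := h
    rw [h']
    simp
  · exact integrableOn_carrier K (continuous_finsetSum _ fun k _ =>
      continuous_fderiv_apply (hs.smul (hv k)) _).continuousOn
  · exact integrableOn_carrier K (continuous_finsetSum _ fun k _ =>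
      (continuous_fderiv_apply hs _).smul (hv k).continuous).continuousOn

/-- The local consistency error of a point residual. -/
lemma norm_add_residual_le (K : Tri) {f : Fin 2 → State m → State m} {v w p : Plane → State m}
    {z : Plane → State m} {ε ε' : ℝ}
    (hv : ∀ k, ContDiff ℝ 1 fun x => f k (v x))
    (hz : ∀ k, ContinuousOn (fun x => f k (z x)) (carrier K))
    (h : ∀ k, ∀ x ∈ carrier K, ‖f k (z x) - f k (v x)‖ ≤ ε)
    (hw : ContinuousOn w (carrier K))
    (heq : ∀ x, w x + ∑ k, fderiv ℝ (fun y => f k (v y)) x (EuclideanSpace.single k 1) = 0)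
    (hp : IsQuadratic p) (hwp : ∀ x ∈ carrier K, ‖w x - p x‖ ≤ ε') (j : LocalNode) :
    ‖w (node K j) + residual K f z j‖ ≤
      7 * massBound * 720 * (hK K / area K * ε) + (1 + 420 * massBound) * ε' := by
  have hM := abs_inv_massMatrix_le K (Sum.inl j)
  have hsum : ∀ {a : LocalDof → State m} {b : ℝ}, (∀ l, ‖a l‖ ≤ b) →
      ‖∑ l, (massMatrix K)⁻¹ (Sum.inl j) l • a l‖ ≤ 7 * (massBound / area K * b) := by
    intro a b hab
    refine (norm_sum_le _ _).trans ((Finset.sum_le_sum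
      (g := fun _ => massBound / area K * b) fun l _ => ?_).trans_eq ?_)
    · rw [norm_smul]
      exact mul_le_mul (hM l) (hab l) (norm_nonneg _)
        (div_nonneg massBound_nonneg (area_pos K).le)
    · simp
  -- The quadratic `p` lies in the local space and its coefficient at the node `j` is its value
  -- there.
  have hproj : ∑ l, (massMatrix K)⁻¹ (Sum.inl j) l • ∫ x in carrier K, shape K l x • p x =
      p (node K j) := by
    refine Eq.trans ?_ (projection_eq K (Sum.elim (fun j => p (node K j))
      fun _ => (3⁻¹ : ℝ) • ∑ i, p (node K (Sum.inr i))) (Sum.inl j))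
    refine Finset.sum_congr rfl fun l _ => ?_
    congr 2
    ext1 x
    congr 1
    rw [Fintype.sum_sum_type]
    simpa using hp.eq_sum K x
  have hload : ∀ l, dgLoad K f v l = - ∫ x in carrier K, shape K l x • w x := by
    intro l
    rw [dgLoad_eq_integral K hv, ← integral_neg]
    congr 1
    ext1 x
    rw [eq_neg_of_add_eq_zero_right (heq x), smul_neg]
  have hsc : ∀ l, ContinuousOn (shape K l) (carrier K) := fun l => (continuous_shape K l).continuousOn
  -- Three errors: approximating `w` by `p` at the node, replacing `v` by `z` in the loads, and
  -- projecting `w - p`. The contributions of `p` itself cancel by `hproj`.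
  have hsplit : w (node K j) + residual K f z j = (w (node K j) - p (node K j))
      + (∑ l, (massMatrix K)⁻¹ (Sum.inl j) l • (dgLoad K f z l - dgLoad K f v l)
      - ∑ l, (massMatrix K)⁻¹ (Sum.inl j) l • ∫ x in carrier K, shape K l x • (w x - p x)) := by
    have h1 : ∀ l, ∫ x in carrier K, shape K l x • (w x - p x) =
        -dgLoad K f v l - ∫ x in carrier K, shape K l x • p x := by
      intro l
      rw [hload, neg_neg, ← integral_sub]
      · simp only [smul_sub]
      · exact integrableOn_carrier K ((hsc l).smul hw)
      · exact integrableOn_carrier K ((hsc l).smul hp.continuous.continuousOn)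
    simp only [h1]
    simp only [smul_sub, smul_neg, Finset.sum_sub_distrib, Finset.sum_neg_distrib]
    rw [hproj, residual]
    abel
  have b1 := hwp _ (node_mem K j)
  have b2 := hsum fun l => norm_dgLoad_sub_le K hz (fun k => (hv k).continuous.continuousOn) h l
  have b3 := hsum (a := fun l => ∫ x in carrier K, shape K l x • (w x - p x))
    (b := 60 * ε' * area K) fun l => norm_setIntegral_carrier_le K fun x hx => by
      rw [norm_smul]
      exact mul_le_mul (abs_shape_le K l hx) (hwp x hx) (norm_nonneg _) (by norm_num)
  rw [hsplit]
  refine (norm_add_le _ _).trans ((add_le_add b1 ((norm_sub_le _ _).trans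
    (add_le_add b2 b3))).trans_eq ?_)
  have := (area_pos K).ne'
  field_simp
  ring

/-! ### Overlaps, areas and the number of cells at a point -/

namespace Triangulation

variable (𝒯 : Triangulation)

/-- Otherwise the vertices of one cell inject into the three vertices of the other, and the two
cells coincide. -/
lemma exists_vertex_notMem {K K' : 𝒯.Cell} (h : K ≠ K') :
    ∃ i, 𝒯.tri K i ∉ range (𝒯.tri K') := by
  by_contra! hc
  choose σ hσ using hc
  have hinj : Function.Injective σ := by
    intro i j hij
    apply (𝒯.tri K).ind.injective
    rw [← hσ i, ← hσ j, hij]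
  have hsurj := Finite.surjective_of_injective hinj
  apply h
  apply 𝒯.distinct
  apply Subset.antisymm
  · rintro _ ⟨i, rfl⟩
    exact ⟨σ i, hσ i⟩
  · rintro _ ⟨i, rfl⟩
    obtain ⟨j, rfl⟩ := hsurj i
    exact ⟨j, (hσ j).symm⟩

/-- The common vertices miss some vertex of `K`, so their hull lies in a proper affine subspace. -/
lemma aedisjoint {K K' : 𝒯.Cell} (h : K ≠ K') :
    AEDisjoint volume (carrier (𝒯.tri K)) (carrier (𝒯.tri K')) := by
  obtain ⟨i, hi⟩ := 𝒯.exists_vertex_notMem h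
  rw [AEDisjoint, 𝒯.conforming K K' h]
  have hsub : convexHull ℝ (range (𝒯.tri K) ∩ range (𝒯.tri K')) ⊆
      (affineSpan ℝ (𝒯.tri K '' (univ \ {i})) : Set Plane) := by
    refine (convexHull_mono ?_).trans (convexHull_subset_affineSpan _)
    rintro _ ⟨⟨j, rfl⟩, hj⟩
    refine ⟨j, ⟨mem_univ _, ?_⟩, rfl⟩
    rintro rfl
    exact hi hj
  refine measure_mono_null hsub (Measure.addHaar_affineSubspace _ _ fun htop => ?_)
  have := (𝒯.tri K).ind.notMem_affineSpan_sdiff i univ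
  rw [htop] at this
  exact this (AffineSubspace.mem_top _ _ _)

lemma nullMeasurableSet_carrier (K : Tri) : NullMeasurableSet (carrier K) volume :=
  (isCompact_carrier K).measurableSet.nullMeasurableSet

lemma finite_meets {S : Set Plane} (hS : IsCompact S) :
    {K | (carrier (𝒯.tri K) ∩ S).Nonempty}.Finite :=
  𝒯.locallyFinite.finite_nonempty_inter_compact hS

/-- Measurable pieces of different triangles are almost disjoint. -/
lemma sum_measure_le (F : Finset 𝒯.Cell) (S : 𝒯.Cell → Set Plane)
    (hS : ∀ K ∈ F, MeasurableSet (S K)) (hsub : ∀ K ∈ F, S K ⊆ carrier (𝒯.tri K))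
    {R : Set Plane} (hR : ∀ K ∈ F, S K ⊆ R) (hRf : volume R ≠ ⊤) :
    ∑ K ∈ F, volume.real (S K) ≤ volume.real R := by
  rw [← measureReal_biUnion_finset₀ (fun K hK K' hK' hne => (𝒯.aedisjoint hne).mono (hsub K hK)
    (hsub K' hK')) (fun K hK => (hS K hK).nullMeasurableSet)
    (fun K hK => measure_ne_top_of_subset (hR K hK) hRf)]
  exact measureReal_mono (iUnion₂_subset hR) hRf

lemma sum_area_le (F : Finset 𝒯.Cell) {R : Set Plane} (hR : ∀ K ∈ F, carrier (𝒯.tri K) ⊆ R)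
    (hRf : volume R ≠ ⊤) : ∑ K ∈ F, area (𝒯.tri K) ≤ volume.real R :=
  𝒯.sum_measure_le F (fun K => carrier (𝒯.tri K))
    (fun _ _ => (isCompact_carrier _).measurableSet) (fun _ _ => subset_rfl) hR hRf

variable {𝒯}

/-- Shape regularity bounds the number of triangles at a point. -/
lemma card_le_of_mem {γ : ℝ} (hγ : 𝒯.Regular γ) (σ : Plane) (F : Finset 𝒯.Cell)
    (hF : ∀ K ∈ F, σ ∈ carrier (𝒯.tri K)) :
    (F.card : ℝ) ≤ γ * volume.real (Metric.ball (0 : Plane) 1) := by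
  have hreg : ∀ K, hK (𝒯.tri K) ^ 2 ≤ γ * area (𝒯.tri K) := hγ
  have hγ0 : 0 ≤ γ := by
    obtain ⟨K, _⟩ := 𝒯.covers 0
    exact le_of_mul_le_mul_right ((zero_mul _).trans_le ((sq_nonneg _).trans (hreg K)))
      (area_pos (𝒯.tri K))
  rcases F.eq_empty_or_nonempty with rfl | hne
  · simp only [Finset.card_empty, Nat.cast_zero]
    exact mul_nonneg hγ0 measureReal_nonneg
  obtain ⟨K₀, hK₀, hmin⟩ := F.exists_min_image (fun K => hK (𝒯.tri K)) hne
  set r := hK (𝒯.tri K₀)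
  have hr : 0 < r := hK_pos _
  -- Each triangle is shrunk towards `σ` to the smallest diameter `r`. The copies stay inside their
  -- triangles, lie in the ball of radius `r` and have area at least `r² / γ`, so a comparison of
  -- areas counts them.
  set ρ : 𝒯.Cell → ℝ := fun K => r / hK (𝒯.tri K)
  have hρ0 : ∀ K, 0 < ρ K := fun K => div_pos hr (hK_pos _)
  have hρ1 : ∀ K ∈ F, ρ K ≤ 1 := fun K hKF => (div_le_one (hK_pos _)).2 (hmin K hKF)
  set S : 𝒯.Cell → Set Plane := fun K => AffineMap.homothety σ (ρ K) '' carrier (𝒯.tri K)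
  have hvol : ∀ K, volume.real (S K) = ρ K ^ 2 * area (𝒯.tri K) := by
    intro K
    simp only [S, measureReal_def, Measure.addHaar_image_homothety, ENNReal.toReal_mul]
    rw [ENNReal.toReal_ofReal (abs_nonneg _)]
    simp [area, measureReal_def]
  have hle := 𝒯.sum_measure_le F S (R := Metric.closedBall σ r)
    (fun K _ => ((isCompact_carrier _).image
      (AffineMap.continuous_of_finiteDimensional _)).measurableSet)
    (by
      rintro K hKF _ ⟨x, hx, rfl⟩
      rw [AffineMap.homothety_eq_lineMap]
      exact (convex_carrier _).lineMap_mem (hF K hKF) hx ⟨(hρ0 K).le, hρ1 K hKF⟩)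
    (by
      rintro K hKF _ ⟨x, hx, rfl⟩
      rw [mem_closedBall_iff_norm, AffineMap.homothety_apply]
      simp only [vsub_eq_sub, vadd_eq_add, add_sub_cancel_right, norm_smul,
        Real.norm_of_nonneg (hρ0 K).le]
      calc ρ K * ‖x - σ‖ ≤ ρ K * hK (𝒯.tri K) :=
            mul_le_mul_of_nonneg_left (dist_le_hK _ hx (hF K hKF)) (hρ0 K).le
        _ = r := div_mul_cancel₀ _ (hK_pos _).ne')
    measure_closedBall_lt_top.ne
  rw [Measure.addHaar_real_closedBall _ _ hr.le] at hle
  simp only [finrank_euclideanSpace, Fintype.card_fin, hvol] at hle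
  have hlow : ∀ K ∈ F, r ^ 2 ≤ γ * (ρ K ^ 2 * area (𝒯.tri K)) := by
    intro K _
    have h1 := mul_le_mul_of_nonneg_left (hreg K) (sq_nonneg (ρ K))
    have h2 : ρ K ^ 2 * hK (𝒯.tri K) ^ 2 = r ^ 2 := by
      rw [← mul_pow, div_mul_cancel₀ _ (hK_pos _).ne']
    linarith
  have h3 := Finset.sum_le_sum hlow
  rw [Finset.sum_const, nsmul_eq_mul, ← Finset.mul_sum] at h3
  have h4 := mul_le_mul_of_nonneg_left hle hγ0
  have h5 : (F.card : ℝ) * r ^ 2 ≤ (γ * volume.real (Metric.ball (0 : Plane) 1)) * r ^ 2 := by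
    linarith
  exact le_of_mul_le_mul_right h5 (by positivity)

end Triangulation

/-! ### Continuity of the interpolant across cells -/

/-- A point of the hull of some vertices of a triangle: sums against the barycentric coordinates
depend only on these vertices. -/
lemma exists_weights {T : Finset Plane} {x : Plane} (hx : x ∈ convexHull ℝ (T : Set Plane)) :
    ∃ w : Plane → ℝ, ∀ K : Tri, (T : Set Plane) ⊆ range K →
      (∀ i, K i ∉ T → K.coord i x = 0) ∧
      ∀ {E : Type} [AddCommGroup E] [Module ℝ E] (g : Plane → E),
        ∑ i, K.coord i x • g (K i) = ∑ p ∈ T, w p • g p := by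
  obtain ⟨w, -, hw1, hw⟩ := Finset.mem_convexHull'.1 hx
  refine ⟨w, fun K hT => ?_⟩
  have hc : ∀ i, K.coord i x = ∑ p ∈ T, w p * K.coord i p := by
    intro i
    have h0 : ∀ y, K.coord i y = (K.coord i).linear y + K.coord i 0 := by
      intro y
      have := coord_add K i 0 y
      rw [zero_add] at this
      rw [this, add_comm]
    rw [h0 x, Finset.sum_congr rfl fun p _ => by rw [h0 p]]
    simp only [mul_add, Finset.sum_add_distrib, ← Finset.sum_mul, hw1, one_mul]
    rw [← hw, map_sum]
    simp only [map_smul, smul_eq_mul]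
  constructor
  · intro i hi
    rw [hc]
    refine Finset.sum_eq_zero fun p hp => ?_
    obtain ⟨j, rfl⟩ := hT hp
    rw [K.coord_apply_ne, mul_zero]
    rintro rfl
    exact hi hp
  · intro E _ _ g
    simp only [hc, Finset.sum_smul]
    rw [Finset.sum_comm]
    refine Finset.sum_congr rfl fun p hp => ?_
    obtain ⟨j, rfl⟩ := hT hp
    simp only [mul_smul, ← Finset.smul_sum]
    congr 1
    rw [Finset.sum_eq_single j]
    · simp
    · intro i _ hij
      rw [K.coord_apply_ne hij, zero_smul]
    · simp

/-- On the boundary the bubble, and with it the cell average, drops out. The symmetric double sum,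
whose diagonal midpoints are the vertices, is independent of the numbering and fits
`exists_weights`. -/
lemma interp_of_coord_eq_zero (K : Tri) (v : Plane → State m) {x : Plane} {i : Fin 3}
    (hi : K.coord i x = 0) :
    interp K v x = ∑ i, K.coord i x • ((∑ j, K.coord j x • (2 : ℝ) • v (midpoint ℝ (K i) (K j)))
      - v (K i)) := by
  have hb : bubble K x = 0 := by
    rw [bubble, Finset.prod_eq_zero (Finset.mem_univ i) hi, mul_zero]
  have hs := K.sum_coord_apply_eq_one x
  rw [interp, Fintype.sum_sum_type]
  simp only [shape, hb, zero_div, sub_zero, zero_smul, add_zero, node, Fin.sum_univ_three,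
    midpoint_self, Fin.isValue, show (0 : Fin 3) + 1 = 1 from rfl,
    show (1 : Fin 3) + 1 = 2 from rfl, show (2 : Fin 3) + 1 = 0 from rfl,
    midpoint_comm (K 1) (K 0), midpoint_comm (K 2) (K 1), midpoint_comm (K 0) (K 2)]
  module

/-- A shared point is a convex combination of shared vertices with weights independent of the cell,
so both traces reduce to the same sums. -/
lemma Triangulation.interp_eq_interp (𝒯 : Triangulation) {K K' : 𝒯.Cell} (v : Plane → State m)
    {x : Plane} (hx : x ∈ carrier (𝒯.tri K)) (hx' : x ∈ carrier (𝒯.tri K')) :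
    interp (𝒯.tri K) v x = interp (𝒯.tri K') v x := by
  by_cases h : K = K'
  · rw [h]
  have hmem : x ∈ convexHull ℝ (range (𝒯.tri K) ∩ range (𝒯.tri K')) := by
    rw [← 𝒯.conforming K K' h]
    exact ⟨hx, hx'⟩
  have hfin : (range (𝒯.tri K) ∩ range (𝒯.tri K')).Finite := (finite_range _).inter_of_left _
  rw [← hfin.coe_toFinset] at hmem
  obtain ⟨w, hw⟩ := exists_weights hmem
  obtain ⟨z, hsum⟩ := hw (𝒯.tri K) (by simp)
  obtain ⟨z', hsum'⟩ := hw (𝒯.tri K') (by simp)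
  obtain ⟨i, hi⟩ := 𝒯.exists_vertex_notMem h
  obtain ⟨i', hi'⟩ := 𝒯.exists_vertex_notMem (Ne.symm h)
  have h0 : (𝒯.tri K).coord i x = 0 := z i (by simpa using hi)
  have h0' : (𝒯.tri K').coord i' x = 0 := z' i' (by simpa using hi')
  have e1 : ∀ p, ∑ j, (𝒯.tri K).coord j x • (2 : ℝ) • v (midpoint ℝ p (𝒯.tri K j)) =
      ∑ j, (𝒯.tri K').coord j x • (2 : ℝ) • v (midpoint ℝ p (𝒯.tri K' j)) := fun p => by
    rw [hsum fun q => (2 : ℝ) • v (midpoint ℝ p q), hsum' fun q => (2 : ℝ) • v (midpoint ℝ p q)]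
  rw [interp_of_coord_eq_zero _ v h0, interp_of_coord_eq_zero _ v h0']
  simp only [e1]
  rw [hsum fun p => (∑ j, (𝒯.tri K').coord j x • (2 : ℝ) • v (midpoint ℝ p (𝒯.tri K' j))) - v p,
    hsum' fun p => (∑ j, (𝒯.tri K').coord j x • (2 : ℝ) • v (midpoint ℝ p (𝒯.tri K' j))) - v p]

/-! ### Cancellation of boundary fluxes over the mesh -/

namespace Triangulation

variable (𝒯 : Triangulation)

lemma continuous_of_continuousOn {Y : Type*} [TopologicalSpace Y] {g : Plane → Y}
    (h : ∀ K, ContinuousOn g (carrier (𝒯.tri K))) : Continuous g :=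
  𝒯.locallyFinite.continuous (eq_univ_of_forall fun x => mem_iUnion.2 (𝒯.covers x))
    (fun _ => (isCompact_carrier _).isClosed) h

/-- The interpolant as a function on the plane. -/
noncomputable def glue (v : Plane → State m) (x : Plane) : State m :=
  interp (𝒯.tri (𝒯.covers x).choose) v x

lemma glue_eq (v : Plane → State m) {K : 𝒯.Cell} {x : Plane} (hx : x ∈ carrier (𝒯.tri K)) :
    𝒯.glue v x = interp (𝒯.tri K) v x :=
  𝒯.interp_eq_interp v (𝒯.covers x).choose_spec hx

/-- Integration by parts against the constant 1. -/
lemma integral_fderiv_eq_zero {g : Plane → State m} (hg : ContDiff ℝ 1 g)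
    (hgc : HasCompactSupport g) (v : Plane) : ∫ x, fderiv ℝ g x v = 0 := by
  have h1 : Integrable fun x => fderiv ℝ g x v :=
    (continuous_fderiv_apply hg v).integrable_of_hasCompactSupport (hgc.fderiv_apply ℝ v)
  have h2 : Integrable g := hg.continuous.integrable_of_hasCompactSupport hgc
  have h := integral_bilinear_hasFDerivAt_right_eq_neg_left_of_integrable (μ := volume)
    (f := fun _ : Plane => (1 : ℝ)) (f' := fun _ => 0) (g := g) (g' := fderiv ℝ g) (v := v)
    (B := ContinuousLinearMap.lsmul ℝ ℝ) (by simp) (by simpa using h1) (by simpa using h2)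
    (fun x _ => hasFDerivAt_const _ _)
    (fun x _ => (hg.differentiable one_ne_zero x).hasFDerivAt)
  simpa using h

lemma boundaryFlux_congr (K : Tri) {w w' : Plane → ℝ} {G H : Fin 2 → Plane → State m}
    (hw : ∀ x ∈ carrier K, w x = w' x) (h : ∀ k, ∀ x ∈ carrier K, G k x = H k x) :
    boundaryFlux K w G = boundaryFlux K w' H := by
  unfold boundaryFlux
  refine Finset.sum_congr rfl fun i _ => intervalIntegral.integral_congr fun s hs => ?_
  rw [uIcc_of_le zero_le_one] at hs
  have hx := lineMap_mem K i (i + 1) hs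
  simp only [hw _ hx, h _ _ hx]

lemma sum_integral_carrier (F : Finset 𝒯.Cell) {g : Plane → State m} (hg : Continuous g)
    (hF : ∀ x, g x ≠ 0 → ∃ K ∈ F, x ∈ carrier (𝒯.tri K)) :
    ∑ K ∈ F, ∫ x in carrier (𝒯.tri K), g x = ∫ x, g x := by
  have h1 := integral_iUnion_ae (μ := volume) (f := g)
    (s := fun K : F => carrier (𝒯.tri K)) (fun K => nullMeasurableSet_carrier _)
    (fun K K' hne => 𝒯.aedisjoint fun h => hne (Subtype.ext h))
    (hg.continuousOn.integrableOn_compact (isCompact_iUnion fun K => isCompact_carrier _))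
  rw [tsum_fintype, Finset.sum_coe_sort F (fun K => ∫ x in carrier (𝒯.tri K), g x)] at h1
  rw [← h1]
  refine setIntegral_eq_integral_of_forall_compl_eq_zero fun x hx => ?_
  by_contra hne
  obtain ⟨K, hK, hxK⟩ := hF x hne
  exact hx (mem_iUnion.2 ⟨⟨K, hK⟩, hxK⟩)

/-- The divergence theorem on each cell turns the sum into the integral of a compactly supported
divergence over the plane. -/
lemma sum_boundaryFlux_smooth (F : Finset 𝒯.Cell) {H : Fin 2 → Plane → State m}
    (hH : ∀ k, ContDiff ℝ 1 (H k)) {S : Set Plane} (hS : IsCompact S)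
    (hHS : ∀ k, ∀ x ∉ S, H k x = 0) (hF : ∀ x ∈ S, ∃ K ∈ F, x ∈ carrier (𝒯.tri K)) :
    ∑ K ∈ F, boundaryFlux (𝒯.tri K) (fun _ => 1) H = 0 := by
  have hsupp : ∀ k, HasCompactSupport (H k) := fun k => HasCompactSupport.intro hS (hHS k)
  have hts : ∀ k, tsupport (H k) ⊆ S := fun k =>
    closure_minimal (fun x hx => by_contra fun h => hx (hHS k x h)) hS.isClosed
  simp only [boundaryFlux_eq_integral_div _ hH]
  rw [sum_integral_carrier 𝒯 F (continuous_finsetSum _ fun k _ => continuous_fderiv_apply (hH k) _),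
    integral_finsetSum]
  · exact Finset.sum_eq_zero fun k _ => integral_fderiv_eq_zero (hH k) (hsupp k) _
  · exact fun k _ => (continuous_fderiv_apply (hH k) _).integrable_of_hasCompactSupport
      ((hsupp k).fderiv_apply ℝ _)
  · intro x hx
    apply hF
    by_contra hxS
    apply hx
    refine Finset.sum_eq_zero fun k _ => ?_
    rw [image_eq_zero_of_notMem_tsupport fun h => hxS (hts k (tsupport_fderiv_subset ℝ h))]
    rfl

/-- The boundary fluxes of a continuous field of compact support cancel. -/
lemma sum_boundaryFlux_eq_zero {G : Fin 2 → Plane → State m} (hG : ∀ k, Continuous (G k))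
    {R : ℝ} (hGR : ∀ k x, R < ‖x‖ → G k x = 0) (F : Finset 𝒯.Cell)
    (hF : ∀ K, (carrier (𝒯.tri K) ∩ Metric.closedBall 0 (R + 1)).Nonempty → K ∈ F) :
    ∑ K ∈ F, boundaryFlux (𝒯.tri K) (fun _ => 1) G = 0 := by
  have hcs : ∀ k, HasCompactSupport (G k) := fun k =>
    HasCompactSupport.intro (isCompact_closedBall 0 R) fun x hx => hGR k x (by simpa using hx)
  -- Uniform approximation by `C¹` fields reduces to the smooth case and avoids pairing the edges of
  -- neighbouring cells. As `F` is fixed, `ε` can tend to zero.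
  have key : ∀ ε > 0, ‖∑ K ∈ F, boundaryFlux (𝒯.tri K) (fun _ => 1) G‖ ≤
      (∑ K ∈ F, 6 * hK (𝒯.tri K)) * ε := by
    intro ε hε
    have hex : ∀ k, ∃ H : Plane → State m, ContDiff ℝ 1 H ∧ (∀ x, ‖G k x - H x‖ ≤ ε) ∧
        ∀ x ∉ Metric.closedBall (0 : Plane) (R + 1), H x = 0 := by
      intro k
      have huc := (hcs k).uniformContinuous_of_continuous (hG k)
      obtain ⟨δ, hδ, hd⟩ := Metric.uniformContinuous_iff.1 huc ε hε
      -- A smoothing radius of at most 1 keeps the support in the ball of radius `R + 1`, which the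
      -- cells of `F` cover.
      obtain ⟨H, hH, hb⟩ := (hG k).exists_contDiff_dist_le_of_forall_mem_ball_dist_le
        (lt_min hδ one_pos)
      refine ⟨H, hH.of_le (by exact_mod_cast le_top), fun x => ?_, fun x hx => ?_⟩
      · rw [← dist_eq_norm, dist_comm]
        exact hb x ε fun y hy => (hd ((Metric.mem_ball.1 hy).trans_le (min_le_left _ _))).le
      · have hx' : R + 1 < ‖x‖ := by simpa using hx
        have hz : ∀ y ∈ Metric.ball x (min δ 1), G k y = 0 := by
          intro y hy
          apply hGR
          have h1 := (mem_ball_iff_norm.1 hy).trans_le (min_le_right _ _)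
          have h2 := norm_sub_norm_le x y
          rw [norm_sub_rev] at h2
          linarith
        have hx0 := hz x (Metric.mem_ball_self (lt_min hδ one_pos))
        have := hb x 0 fun y hy => by rw [hz y hy, hx0, dist_self]
        rw [hx0] at this
        simpa using this
    choose H hH hb hz using hex
    have h0 := 𝒯.sum_boundaryFlux_smooth F hH (isCompact_closedBall 0 (R + 1)) hz
      (fun x hx => by
        obtain ⟨K, hK⟩ := 𝒯.covers x
        exact ⟨K, hF K ⟨x, hK, hx⟩, hK⟩)
    rw [← sub_zero (∑ K ∈ F, _), ← h0, ← Finset.sum_sub_distrib, Finset.sum_mul]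
    refine norm_sum_le_of_le _ fun K _ => ?_
    rw [← boundaryFlux_sub _ (fun k => (hG k).continuousOn) fun k => (hH k).continuous.continuousOn]
    exact norm_boundaryFlux_le _ fun k x _ => by rw [one_smul]; exact hb k x
  rw [← norm_le_zero_iff]
  refine ge_of_tendsto (x := 𝓝[>] (0 : ℝ)) (f := fun ε => (∑ K ∈ F, 6 * hK (𝒯.tri K)) * ε) ?_
    (Filter.eventually_of_mem self_mem_nhdsWithin key)
  have : Filter.Tendsto (fun ε : ℝ => (∑ K ∈ F, 6 * hK (𝒯.tri K)) * ε) (𝓝 0) (𝓝 0) := by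
    simpa using (Filter.tendsto_id (x := 𝓝 (0 : ℝ))).const_mul (∑ K ∈ F, 6 * hK (𝒯.tri K))
  exact this.mono_left nhdsWithin_le_nhds

variable {𝒯}

/-! ### The point defect of the scheme -/

/-- The defect at a point value is controlled by the local consistency errors at that point. -/
lemma norm_pointDefect_le {γ Cω : ℝ} (hγ : 𝒯.Regular γ) {f : Fin 2 → State m → State m} {T : ℝ}
    {u : ℝ → Plane → State m} {t : ℝ} {ω : 𝒯.Cell → LocalNode → (State m →L[ℝ] State m)}
    (hω : 𝒯.SumToId ω) (hωb : ∀ K j, ‖ω K j‖ ≤ Cω) {K₀ : 𝒯.Cell} {j₀ : LocalNode} {ε : ℝ}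
    (h : ∀ K j, node (𝒯.tri K) j = node (𝒯.tri K₀) j₀ →
      ‖derivWithin (fun s => u s (node (𝒯.tri K) j)) (Icc 0 T) t
          + residual (𝒯.tri K) f (interp (𝒯.tri K) (u t)) j‖ ≤ ε) :
    ‖pointDefect 𝒯 f T u t ω (node (𝒯.tri K₀) j₀)‖ ≤
      6 * (γ * volume.real (Metric.ball (0 : Plane) 1)) * (Cω * ε) := by
  classical
  set σ := node (𝒯.tri K₀) j₀ with hσ
  have hfinC := 𝒯.finite_meets (isCompact_singleton (x := σ))
  set F := hfinC.toFinset
  have hFmem : ∀ K ∈ F, σ ∈ carrier (𝒯.tri K) := by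
    intro K hKF
    obtain ⟨x, hx, rfl⟩ := (hfinC.mem_toFinset.1 hKF)
    exact hx
  set P : Finset (𝒯.Cell × LocalNode) :=
    (F ×ˢ Finset.univ).filter fun p => node (𝒯.tri p.1) p.2 = σ with hP
  have hPmem : ∀ p, p ∈ P ↔ node (𝒯.tri p.1) p.2 = σ := by
    intro p
    simp only [hP, Finset.mem_filter, Finset.mem_product, Finset.mem_univ, and_true,
      and_iff_right_iff_imp]
    intro hp
    exact hfinC.mem_toFinset.2 ⟨σ, hp ▸ node_mem _ _, rfl⟩
  have hsum : ∀ {E : Type} [AddCommMonoid E] (g : 𝒯.Cell × LocalNode → E),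
      ∑ᶠ (p : 𝒯.Cell × LocalNode) (_ : node (𝒯.tri p.1) p.2 = σ), g p = ∑ p ∈ P, g p :=
    fun g => finsum_cond_eq_sum_of_cond_iff g fun {p} _ => (hPmem p).symm
  have hid := hω K₀ j₀
  rw [← hσ, hsum fun p => ω p.1 p.2] at hid
  have hε : 0 ≤ ε := (norm_nonneg _).trans (h K₀ j₀ rfl)
  have hC : 0 ≤ Cω := (norm_nonneg _).trans (hωb K₀ j₀)
  -- Since the weights sum to the identity, the time derivative can be distributed over the cells at
  -- `σ`.
  have heq : pointDefect 𝒯 f T u t ω σ = ∑ p ∈ P, ω p.1 p.2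
      (derivWithin (fun s => u s (node (𝒯.tri p.1) p.2)) (Icc 0 T) t
          + residual (𝒯.tri p.1) f (interp (𝒯.tri p.1) (u t)) p.2) := by
    rw [pointDefect, hsum fun p => ω p.1 p.2 (residual (𝒯.tri p.1) f (interp (𝒯.tri p.1) (u t)) p.2)]
    have h1 := congrArg (fun A : State m →L[ℝ] State m =>
      A (derivWithin (fun s => u s σ) (Icc 0 T) t)) hid
    simp only [_root_.sum_apply, ContinuousLinearMap.id_apply] at h1
    nth_rewrite 1 [← h1]
    rw [← Finset.sum_add_distrib]
    refine Finset.sum_congr rfl fun p hp => ?_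
    rw [map_add, (hPmem p).1 hp]
  have hcard : (P.card : ℝ) ≤ 6 * (γ * volume.real (Metric.ball (0 : Plane) 1)) := by
    have h1 : P.card ≤ F.card * 6 := by
      refine (Finset.card_filter_le _ _).trans ?_
      rw [Finset.card_product]
      simp
    have h2 : (P.card : ℝ) ≤ F.card * 6 := by exact_mod_cast h1
    linarith [card_le_of_mem hγ σ F hFmem]
  rw [heq]
  refine (norm_sum_le_of_le _ (n := fun _ => Cω * ε) fun p hp => ?_).trans ?_
  · refine (ContinuousLinearMap.le_opNorm _ _).trans ?_
    exact mul_le_mul (hωb _ _) (h _ _ ((hPmem p).1 hp)) (norm_nonneg _) hC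
  · rw [Finset.sum_const, nsmul_eq_mul]
    exact mul_le_mul_of_nonneg_right hcard (mul_nonneg hC hε)

end Triangulation

/-! ### Taylor estimates on convex sets -/

section Taylor

set_option maxSynthPendingDepth 3

variable {X E : Type*} [NormedAddCommGroup X] [NormedSpace ℝ X] [NormedAddCommGroup E]
  [NormedSpace ℝ E]

/-- The mean value inequality on the part of `Ω` within distance `‖x - a‖` of `a`. Applied
repeatedly it gives Taylor bounds, without the factorials. -/
lemma norm_le_of_norm_fderivWithin_le {g : X → E} {g' : X → X →L[ℝ] E} {Ω : Set X}
    (hΩ : Convex ℝ Ω) {a : X} (ha : a ∈ Ω) {B : ℝ} (hB : 0 ≤ B) {n : ℕ}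
    (hd : ∀ x ∈ Ω, HasFDerivWithinAt g (g' x) Ω x) (h0 : g a = 0)
    (hb : ∀ x ∈ Ω, ‖g' x‖ ≤ B * ‖x - a‖ ^ n) {x : X} (hx : x ∈ Ω) :
    ‖g x‖ ≤ B * ‖x - a‖ ^ (n + 1) := by
  have h := (hΩ.inter (convex_closedBall a ‖x - a‖)).norm_image_sub_le_of_norm_hasFDerivWithin_le
    (f := g) (f' := g') (C := B * ‖x - a‖ ^ n) (x := a) (y := x)
    (fun y hy => (hd y hy.1).mono inter_subset_left)
    (fun y hy => (hb y hy.1).trans (mul_le_mul_of_nonneg_left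
      (pow_le_pow_left₀ (norm_nonneg _) (mem_closedBall_iff_norm.1 hy.2) n) hB))
    ⟨ha, Metric.mem_closedBall_self (norm_nonneg _)⟩ ⟨hx, mem_closedBall_iff_norm.2 le_rfl⟩
  rw [h0, sub_zero] at h
  exact h.trans_eq (by ring)

/-- Taylor's formula of first order. -/
lemma norm_sub_taylor_one_le {w : X → E} {w1 : X → X →L[ℝ] E} {w2 : X → X →L[ℝ] X →L[ℝ] E}
    {Ω : Set X} (hΩ : Convex ℝ Ω) {B : ℝ} (h1 : ∀ x ∈ Ω, HasFDerivWithinAt w (w1 x) Ω x)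
    (h2 : ∀ x ∈ Ω, HasFDerivWithinAt w1 (w2 x) Ω x) (hb : ∀ x ∈ Ω, ‖w2 x‖ ≤ B)
    {a x : X} (ha : a ∈ Ω) (hx : x ∈ Ω) :
    ‖w x - (w a + w1 a (x - a))‖ ≤ B * ‖x - a‖ ^ 2 := by
  have hB : 0 ≤ B := (norm_nonneg _).trans (hb a ha)
  have e1 : ∀ y ∈ Ω, ‖w1 y - w1 a‖ ≤ B * ‖y - a‖ ^ 1 := fun y hy =>
    norm_le_of_norm_fderivWithin_le (g := fun y => w1 y - w1 a) (n := 0) hΩ ha hB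
      (fun z hz => (h2 z hz).sub_const _) (sub_self _) (fun z hz => by simpa using hb z hz) hy
  exact norm_le_of_norm_fderivWithin_le (g := fun y => w y - (w a + w1 a (y - a)))
    (g' := fun y => w1 y - w1 a) hΩ ha hB
    (fun z hz => (h1 z hz).sub (((w1 a).hasFDerivWithinAt.comp z
      ((hasFDerivWithinAt_id z Ω).sub_const a) (mapsTo_univ _ _)).const_add (w a)))
    (by simp) e1 hx

/-- Taylor's formula of second order. -/
lemma norm_sub_taylor_two_le {w : X → E} {w1 : X → X →L[ℝ] E} {w2 : X → X →L[ℝ] X →L[ℝ] E}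
    {w3 : X → X →L[ℝ] X →L[ℝ] X →L[ℝ] E} {Ω : Set X} (hΩ : Convex ℝ Ω) {B : ℝ}
    (h1 : ∀ x, HasFDerivAt w (w1 x) x) (h2 : ∀ x, HasFDerivAt w1 (w2 x) x)
    (h3 : ∀ x, HasFDerivAt w2 (w3 x) x) (hb : ∀ x ∈ Ω, ‖w3 x‖ ≤ B)
    {a x : X} (ha : a ∈ Ω) (hx : x ∈ Ω) :
    ‖w x - (w a + w1 a (x - a) + (2⁻¹ : ℝ) • w2 a (x - a) (x - a))‖ ≤ B * ‖x - a‖ ^ 3 := by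
  have hB : 0 ≤ B := (norm_nonneg _).trans (hb a ha)
  have e1 : ∀ y ∈ Ω, ‖w1 y - (w1 a + w2 a (y - a))‖ ≤ B * ‖y - a‖ ^ 2 := fun y hy =>
    norm_sub_taylor_one_le hΩ (fun z _ => (h2 z).hasFDerivWithinAt)
      (fun z _ => (h3 z).hasFDerivWithinAt) hb ha hy
  refine norm_le_of_norm_fderivWithin_le
    (g := fun y => w y - (w a + w1 a (y - a) + (2⁻¹ : ℝ) • w2 a (y - a) (y - a)))
    (g' := fun y => w1 y - (w1 a + w2 a (y - a))) hΩ ha hB (fun z _ => ?_) (by simp) e1 hx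
  have hs : HasFDerivAt (fun y : X => y - a) (ContinuousLinearMap.id ℝ X) z :=
    (hasFDerivAt_id z).sub_const a
  have hl : HasFDerivAt (fun y => w1 a (y - a)) (w1 a) z := (w1 a).hasFDerivAt.comp z hs
  have hl2 : HasFDerivAt (fun y => w2 a (y - a)) (w2 a) z := (w2 a).hasFDerivAt.comp z hs
  have hq := (hl2.clm_apply hs).const_smul (2⁻¹ : ℝ)
  have := (h1 z).sub ((hl.const_add (w a)).add hq)
  refine (this.congr_fderiv ?_).hasFDerivWithinAt
  ext y
  -- The quadratic term differentiates into two halves, which combine only by symmetry of the second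
  -- derivative.
  have hz := second_derivative_symmetric h1 (h2 a) z y
  have ha := second_derivative_symmetric h1 (h2 a) a y
  simp [hz, ha]
  module

end Taylor

/-! ### Space and time derivatives on the closed strip, with uniform bounds -/

section Slices

variable {Y E : Type*} [NormedAddCommGroup Y] [NormedSpace ℝ Y] [NormedAddCommGroup E]
  [NormedSpace ℝ E]

lemma uniqueDiffOn_strip {T : ℝ} (hT : 0 < T) :
    UniqueDiffOn ℝ (Icc 0 T ×ˢ (univ : Set Y)) :=
  (uniqueDiffOn_Icc hT).prod uniqueDiffOn_univ

lemma exists_space_deriv {T : ℝ} (hT : 0 < T) {F : ℝ × Y → E} {n k : WithTop ℕ∞}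
    (hF : ContDiffOn ℝ n F (Icc 0 T ×ˢ univ)) (hk : k + 1 ≤ n) :
    ∃ F' : ℝ × Y → Y →L[ℝ] E, ContDiffOn ℝ k F' (Icc 0 T ×ˢ univ) ∧
      ∀ t ∈ Icc 0 T, ∀ x, HasFDerivAt (fun y => F (t, y)) (F' (t, x)) x := by
  refine ⟨fun p => (fderivWithin ℝ F (Icc 0 T ×ˢ univ) p).comp (ContinuousLinearMap.inr ℝ ℝ Y),
    (hF.fderivWithin (uniqueDiffOn_strip hT) hk).clm_comp contDiffOn_const, fun t ht x => ?_⟩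
  have hd := ((hF.differentiableOn (ne_of_gt (lt_of_lt_of_le (by simp) hk))) (t, x)
    ⟨ht, mem_univ _⟩).hasFDerivWithinAt
  rw [← hasFDerivWithinAt_univ]
  exact hd.comp x (hasFDerivAt_prodMk_right t x).hasFDerivWithinAt fun y _ => ⟨ht, mem_univ _⟩

lemma exists_time_deriv {T : ℝ} (hT : 0 < T) {F : ℝ × Y → E} {n k : WithTop ℕ∞}
    (hF : ContDiffOn ℝ n F (Icc 0 T ×ˢ univ)) (hk : k + 1 ≤ n) :
    ∃ F' : ℝ × Y → ℝ →L[ℝ] E, ContDiffOn ℝ k F' (Icc 0 T ×ˢ univ) ∧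
      ∀ t ∈ Icc 0 T, ∀ x, HasFDerivWithinAt (fun s => F (s, x)) (F' (t, x)) (Icc 0 T) t := by
  refine ⟨fun p => (fderivWithin ℝ F (Icc 0 T ×ˢ univ) p).comp (ContinuousLinearMap.inl ℝ ℝ Y),
    (hF.fderivWithin (uniqueDiffOn_strip hT) hk).clm_comp contDiffOn_const, fun t ht x => ?_⟩
  have hd := ((hF.differentiableOn (ne_of_gt (lt_of_lt_of_le (by simp) hk))) (t, x)
    ⟨ht, mem_univ _⟩).hasFDerivWithinAt
  exact HasFDerivWithinAt.comp (f := fun s => (s, x)) t hd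
    (hasFDerivAt_prodMk_left t x).hasFDerivWithinAt fun y hy => ⟨hy, mem_univ _⟩

end Slices

lemma continuous_slice {Y E : Type*} [TopologicalSpace Y] [TopologicalSpace E] {T t : ℝ} (ht : t ∈ Icc 0 T) {F : ℝ × Y → E}
    (hF : ContinuousOn F (Icc 0 T ×ˢ univ)) : Continuous fun x => F (t, x) := by
  rw [← continuousOn_univ]
  exact hF.comp (Continuous.prodMk_right t).continuousOn fun x _ => ⟨ht, mem_univ _⟩

lemma exists_norm_bound {Y E : Type*} [TopologicalSpace Y] [NormedAddCommGroup E] {T : ℝ} {F : ℝ × Y → E} (hF : ContinuousOn F (Icc 0 T ×ˢ univ))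
    {S : Set Y} (hS : IsCompact S) : ∃ B, ∀ t ∈ Icc 0 T, ∀ x ∈ S, ‖F (t, x)‖ ≤ B := by
  obtain ⟨B, hB⟩ := (isCompact_Icc.prod hS).exists_bound_of_continuousOn
    (hF.mono (prod_mono_right (subset_univ S)))
  exact ⟨B, fun t ht x hx => hB (t, x) ⟨ht, hx⟩⟩

set_option maxSynthPendingDepth 3 in
/-- Local approximation of a family of functions by second order Taylor polynomials. -/
lemma exists_quadratic_approx {T : ℝ} (hT : 0 < T) {u : ℝ → Plane → State m}
    (hu : ContDiffOn ℝ 3 (fun p : ℝ × Plane => u p.1 p.2) (Icc 0 T ×ˢ univ)) (R : ℝ) :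
    ∃ B, 0 ≤ B ∧ ∀ t ∈ Icc 0 T, ∀ a ∈ Metric.closedBall (0 : Plane) R, ∃ q, IsQuadratic q ∧
      ∀ x ∈ Metric.closedBall (0 : Plane) R, ‖u t x - q x‖ ≤ B * ‖x - a‖ ^ 3 := by
  obtain ⟨u1, hu1, hd1⟩ := exists_space_deriv hT hu (k := 2) (by norm_num)
  obtain ⟨u2, hu2, hd2⟩ := exists_space_deriv hT hu1 (k := 1) (by norm_num)
  obtain ⟨u3, hu3, hd3⟩ := exists_space_deriv hT hu2 (k := 0) (by norm_num)
  obtain ⟨B, hB⟩ := exists_norm_bound hu3.continuousOn (isCompact_closedBall (0 : Plane) R)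
  refine ⟨|B|, abs_nonneg B, fun t ht a ha =>
    ⟨fun x => u t a + u1 (t, a) (x - a) + (2⁻¹ : ℝ) • u2 (t, a) (x - a) (x - a),
    ⟨a, u t a, u1 (t, a), (2⁻¹ : ℝ) • (ContinuousLinearMap.coeLM ℝ ∘ₗ (u2 (t, a)).toLinearMap),
      fun x => by simp⟩, fun x hx => ?_⟩⟩
  exact norm_sub_taylor_two_le (w3 := fun x => u3 (t, x)) (convex_closedBall 0 R) (hd1 t ht)
    (hd2 t ht) (hd3 t ht) (fun x hx => (hB t ht x hx).trans (le_abs_self B)) ha hx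

/-- Regularity in space of the time derivative. -/
lemma exists_affine_approx {T : ℝ} (hT : 0 < T) {u : ℝ → Plane → State m}
    (hu : ContDiffOn ℝ 3 (fun p : ℝ × Plane => u p.1 p.2) (Icc 0 T ×ˢ univ)) (R : ℝ) :
    ∃ B, 0 ≤ B ∧ ∀ t ∈ Icc 0 T, Continuous (fun x => derivWithin (fun s => u s x) (Icc 0 T) t) ∧
      ∀ a ∈ Metric.closedBall (0 : Plane) R, ∃ q, IsQuadratic q ∧
      ∀ x ∈ Metric.closedBall (0 : Plane) R,
        ‖derivWithin (fun s => u s x) (Icc 0 T) t - q x‖ ≤ B * ‖x - a‖ ^ 2 := by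
  obtain ⟨v, hv, hd⟩ := exists_time_deriv hT hu (k := 2) (by norm_num)
  have hw : ContDiffOn ℝ 2 (fun p => v p 1) (Icc 0 T ×ˢ univ) := hv.clm_apply contDiffOn_const
  have heq : ∀ t ∈ Icc 0 T, ∀ x, derivWithin (fun s => u s x) (Icc 0 T) t = v (t, x) 1 :=
    fun t ht x => (hd t ht x).hasDerivWithinAt.derivWithin (uniqueDiffOn_Icc hT t ht)
  obtain ⟨w1, hw1, hd1⟩ := exists_space_deriv hT hw (k := 1) (by norm_num)
  obtain ⟨w2, hw2, hd2⟩ := exists_space_deriv hT hw1 (k := 0) (by norm_num)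
  obtain ⟨B, hB⟩ := exists_norm_bound hw2.continuousOn (isCompact_closedBall (0 : Plane) R)
  refine ⟨|B|, abs_nonneg B, fun t ht => ⟨?_, fun a ha =>
    ⟨fun x => v (t, a) 1 + w1 (t, a) (x - a), ⟨a, v (t, a) 1, w1 (t, a), 0, fun x => by simp⟩,
    fun x hx => ?_⟩⟩⟩
  · simp only [heq t ht]
    exact continuous_slice ht hw.continuousOn
  · rw [heq t ht]
    exact norm_sub_taylor_one_le (w := fun x => v (t, x) 1) (w1 := fun x => w1 (t, x))
      (w2 := fun x => w2 (t, x)) (convex_closedBall 0 R)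
      (fun x _ => (hd1 t ht x).hasFDerivWithinAt) (fun x _ => (hd2 t ht x).hasFDerivWithinAt)
      (fun x hx => (hB t ht x hx).trans (le_abs_self B)) ha hx

/-- The mean value over a triangle may be differentiated under the integral. -/
lemma derivWithin_cellAverage {T : ℝ} (hT : 0 < T) {u : ℝ → Plane → State m}
    (hu : ContDiffOn ℝ 3 (fun p : ℝ × Plane => u p.1 p.2) (Icc 0 T ×ˢ univ)) (K : Tri) {t : ℝ}
    (ht : t ∈ Icc 0 T) :
    derivWithin (fun s => cellAverage K (u s)) (Icc 0 T) t =
      cellAverage K fun x => derivWithin (fun s => u s x) (Icc 0 T) t := by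
  obtain ⟨v, hv, hd⟩ := exists_time_deriv hT hu (k := 2) (by norm_num)
  obtain ⟨v2, hv2, hd2⟩ := exists_time_deriv hT hv (k := 1) (by norm_num)
  obtain ⟨B, hB⟩ := exists_norm_bound hv2.continuousOn (isCompact_carrier K)
  have heq : ∀ x, derivWithin (fun s => u s x) (Icc 0 T) t = v (t, x) 1 :=
    fun x => (hd t ht x).hasDerivWithinAt.derivWithin (uniqueDiffOn_Icc hT t ht)
  simp only [heq]
  refine HasDerivWithinAt.derivWithin ?_ (uniqueDiffOn_Icc hT t ht)
  unfold cellAverage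
  refine HasDerivWithinAt.const_smul (area K)⁻¹ ?_
  rw [hasDerivWithinAt_iff_isLittleO]
  have hcu : ∀ s ∈ Icc 0 T, IntegrableOn (u s) (carrier K) := fun s hs =>
    integrableOn_carrier K (continuous_slice hs hu.continuousOn).continuousOn
  have hcv : IntegrableOn (fun x => v (t, x) 1) (carrier K) :=
    integrableOn_carrier K ((continuous_slice ht hv.continuousOn).clm_apply
      continuous_const).continuousOn
  -- A Taylor bound in time, uniform over the compact triangle, makes the remainder quadratic also
  -- after integration, including at the end times.
  have hbound : ∀ s ∈ Icc 0 T, ‖(∫ x in carrier K, u s x) - (∫ x in carrier K, u t x)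
      - (s - t) • ∫ x in carrier K, v (t, x) 1‖ ≤ (B * area K) * ‖‖s - t‖ ^ 2‖ := by
    intro s hs
    have hi : (∫ x in carrier K, u s x) - (∫ x in carrier K, u t x)
        - (s - t) • ∫ x in carrier K, v (t, x) 1 =
        ∫ x in carrier K, (u s x - u t x - (s - t) • v (t, x) 1) := by
      rw [integral_sub, integral_sub (hcu s hs) (hcu t ht), integral_smul]
      · exact (hcu s hs).sub (hcu t ht)
      · exact hcv.smul (s - t)
    rw [hi]
    refine (norm_setIntegral_carrier_le K (ε := B * ‖s - t‖ ^ 2) fun x hx => ?_).trans_eq ?_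
    · have h1 := norm_sub_taylor_one_le (w := fun s => u s x) (w1 := fun s => v (s, x))
        (w2 := fun s => v2 (s, x)) (convex_Icc 0 T) (fun s hs => hd s hs x)
        (fun s hs => hd2 s hs x) (fun s hs => hB s hs x hx) ht hs
      have h2 : v (t, x) (s - t) = (s - t) • v (t, x) 1 := by
        rw [← map_smul, smul_eq_mul, mul_one]
      rw [h2, ← sub_sub] at h1
      exact h1
    · rw [norm_pow, norm_norm]
      ring
  refine (Asymptotics.IsBigO.of_bound (B * area K) ?_).trans_isLittleO
    ((Asymptotics.isLittleO_pow_sub_sub t one_lt_two).mono nhdsWithin_le_nhds)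
  filter_upwards [self_mem_nhdsWithin] with s hs using hbound s hs

/-! ### Consistency on a single triangle -/

/-- A `C¹` map is Lipschitz around the points of a compact subset of its domain. -/
lemma exists_lipschitz_near {D Q : Set (State m)} (hD : IsOpen D) (hQ : IsCompact Q) (hQD : Q ⊆ D)
    {f : Fin 2 → State m → State m} (hf : ∀ k, ContDiffOn ℝ 1 (f k) D) :
    ∃ δ L : ℝ, 0 < δ ∧ 0 ≤ L ∧ ∀ q ∈ Q, ∀ y, ‖y - q‖ ≤ δ →
      y ∈ D ∧ ∀ k, ‖f k y - f k q‖ ≤ L * ‖y - q‖ := by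
  obtain ⟨δ, hδ, hsub⟩ := hQ.exists_cthickening_subset_open hD hQD
  have hb : ∀ k, ∃ L, ∀ y ∈ Metric.cthickening δ Q, ‖fderiv ℝ (f k) y‖ ≤ L := fun k =>
    hQ.cthickening.exists_bound_of_continuousOn
      (((hf k).continuousOn_fderiv_of_isOpen hD le_rfl).mono hsub)
  choose L hL using hb
  refine ⟨δ, |L 0| + |L 1|, hδ, by positivity, fun q hq y hy => ?_⟩
  -- The ball about `q` is convex and stays in a compact part of `D`, so the mean value inequality
  -- applies there.
  have hball : Metric.closedBall q δ ⊆ Metric.cthickening δ Q := fun z hz =>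
    Metric.mem_cthickening_of_dist_le z q δ Q hq hz
  have hy' : y ∈ Metric.closedBall q δ := mem_closedBall_iff_norm.2 hy
  refine ⟨hsub (hball hy'), fun k => ?_⟩
  refine (convex_closedBall q δ).norm_image_sub_le_of_norm_hasFDerivWithin_le
    (f' := fderiv ℝ (f k)) (fun z hz => ?_) (fun z hz => ?_)
    (Metric.mem_closedBall_self hδ.le) hy'
  · exact (((hf k).differentiableOn one_ne_zero z (hsub (hball hz))).differentiableAt
      (hD.mem_nhds (hsub (hball hz)))).hasFDerivAt.hasFDerivWithinAt
  · refine (hL k z (hball hz)).trans ((le_abs_self _).trans ?_)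
    fin_cases k
    · exact le_add_of_nonneg_right (abs_nonneg _)
    · exact le_add_of_nonneg_left (abs_nonneg _)

lemma IsSmoothSolution.contDiff_flux {D : Set (State m)} {f : Fin 2 → State m → State m} {T : ℝ}
    {u : ℝ → Plane → State m} (hu : IsSmoothSolution D f T u)
    (hf : ∀ k, ContDiffOn ℝ 1 (f k) D) {t : ℝ} (ht : t ∈ Icc 0 T) (k : Fin 2) :
    ContDiff ℝ 1 fun x => f k (u t x) := by
  rw [← contDiffOn_univ]
  refine (hf k).comp ?_ fun x _ => hu.mem t ht x
  have h1 : ContDiffOn ℝ 1 (fun x : Plane => (t, x)) univ :=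
    (contDiff_const.prodMk contDiff_id).contDiffOn
  exact (hu.contDiffOn.of_le (by norm_num)).comp h1 fun x _ => ⟨ht, mem_univ _⟩

/-- The local consistency of the scheme on a single triangle. -/
lemma exists_local_estimates {D : Set (State m)} (hDo : IsOpen D) {f : Fin 2 → State m → State m}
    (hf : ∀ k, ContDiffOn ℝ 1 (f k) D) {T : ℝ} (hT : 0 < T) {u : ℝ → Plane → State m}
    (hu : IsSmoothSolution D f T u) (R γ : ℝ) :
    ∃ C h₀ : ℝ, 0 ≤ C ∧ 0 < h₀ ∧ ∀ t ∈ Icc 0 T, ∀ K : Tri,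
      carrier K ⊆ Metric.closedBall 0 R → hK K ≤ h₀ → hK K ^ 2 ≤ γ * area K →
      (∀ k, ContinuousOn (fun x => f k (interp K (u t) x)) (carrier K)) ∧
      (∀ k, ∀ x ∈ carrier K, ‖f k (interp K (u t) x) - f k (u t x)‖ ≤ C * hK K ^ 3) ∧
      ∀ j, ‖derivWithin (fun s => u s (node K j)) (Icc 0 T) t
        + residual K f (interp K (u t)) j‖ ≤ C * hK K ^ 2 := by
  set S : Set Plane := Metric.closedBall 0 R
  set Q : Set (State m) := (fun p : ℝ × Plane => u p.1 p.2) '' (Icc 0 T ×ˢ S) with hQdef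
  have hQ : IsCompact Q := (isCompact_Icc.prod (isCompact_closedBall _ _)).image_of_continuousOn
    (hu.contDiffOn.continuousOn.mono (prod_mono_right (subset_univ _)))
  have hQD : Q ⊆ D := by
    rintro _ ⟨p, ⟨hp, -⟩, rfl⟩
    exact hu.mem _ hp _
  obtain ⟨δ, L, hδ, hL, hlip⟩ := exists_lipschitz_near hDo hQ hQD hf
  obtain ⟨B, hB, hquad⟩ := exists_quadratic_approx hT hu.contDiffOn R
  obtain ⟨B', hB', haff⟩ := exists_affine_approx hT hu.contDiffOn R
  set C₁ := L * (421 * B)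
  have hC₁ : 0 ≤ C₁ := by positivity
  set C₂ := 7 * massBound * 720 * (C₁ * |γ|) + (1 + 420 * massBound) * B'
  have hM := massBound_nonneg
  have hC₂ : 0 ≤ C₂ := by positivity
  -- With this `h₀` the interpolation error `421 B h³ ≤ 421 B h` is at most `δ`, so the interpolant
  -- takes values in `D`, where `f` is Lipschitz.
  refine ⟨max C₁ C₂, min 1 (δ / (421 * B + 1)), hC₁.trans (le_max_left _ _),
    lt_min one_pos (by positivity), fun t ht K hKS hKh hreg => ?_⟩
  have hh := hK_pos K
  have hA := area_pos K
  have hh1 : hK K ≤ 1 := hKh.trans (min_le_left _ _)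
  have hcont : Continuous (u t) := continuous_slice ht hu.contDiffOn.continuousOn
  have hint : ∀ x ∈ carrier K, ‖interp K (u t) x - u t x‖ ≤ 421 * B * hK K ^ 3 := by
    intro x hx
    obtain ⟨q, hq, hqb⟩ := hquad t ht _ (hKS (vertex_mem K 0))
    rw [mul_assoc]
    refine norm_interp_sub_le K hcont.continuousOn hq (fun y hy => (hqb y (hKS hy)).trans ?_) hx
    gcongr
    exact dist_le_hK K hy (vertex_mem K 0)
  have hsmall : ∀ x ∈ carrier K, ‖interp K (u t) x - u t x‖ ≤ δ := by
    intro x hx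
    refine (hint x hx).trans ?_
    have h1 : hK K ^ 3 ≤ hK K := pow_le_of_le_one hh.le hh1 (by norm_num)
    have h2 : hK K * (421 * B + 1) ≤ δ :=
      (le_div_iff₀ (by positivity)).1 (hKh.trans (min_le_right _ _))
    nlinarith
  have hl : ∀ x ∈ carrier K, interp K (u t) x ∈ D ∧ ∀ k,
      ‖f k (interp K (u t) x) - f k (u t x)‖ ≤ L * ‖interp K (u t) x - u t x‖ := fun x hx =>
    hlip (u t x) ⟨(t, x), ⟨ht, hKS hx⟩, rfl⟩ _ (hsmall x hx)
  have hc : ∀ k, ContinuousOn (fun x => f k (interp K (u t) x)) (carrier K) := fun k =>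
    (hf k).continuousOn.comp (continuous_interp K (u t)).continuousOn fun x hx => (hl x hx).1
  have hflux : ∀ k, ∀ x ∈ carrier K,
      ‖f k (interp K (u t) x) - f k (u t x)‖ ≤ C₁ * hK K ^ 3 := by
    intro k x hx
    refine ((hl x hx).2 k).trans ?_
    rw [show C₁ * hK K ^ 3 = L * (421 * B * hK K ^ 3) by ring]
    exact mul_le_mul_of_nonneg_left (hint x hx) hL
  refine ⟨hc, fun k x hx => (hflux k x hx).trans
    (mul_le_mul_of_nonneg_right (le_max_left _ _) (by positivity)), fun j => ?_⟩
  obtain ⟨hwc, hwq⟩ := haff t ht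
  obtain ⟨p, hp, hpb⟩ := hwq _ (hKS (vertex_mem K 0))
  have hres := norm_add_residual_le K (v := u t)
    (w := fun x => derivWithin (fun s => u s x) (Icc 0 T) t) (z := interp K (u t))
    (hu.contDiff_flux hf ht) hc hflux hwc.continuousOn (hu.equation t ht) hp
    (ε' := B' * hK K ^ 2) (fun x hx => (hpb x (hKS hx)).trans (by
      gcongr
      exact dist_le_hK K hx (vertex_mem K 0))) j
  refine hres.trans ((?_ : _ ≤ C₂ * hK K ^ 2).trans
    (mul_le_mul_of_nonneg_right (le_max_right _ _) (by positivity)))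
  -- Shape regularity absorbs the `1 / |K|` of the inverse mass matrix at the cost of two powers of
  -- `h_K`.
  have h1 : hK K / area K * (C₁ * hK K ^ 3) ≤ C₁ * |γ| * hK K ^ 2 := by
    have h2 : hK K ^ 2 / area K ≤ |γ| := (div_le_iff₀ hA).2
      (hreg.trans (mul_le_mul_of_nonneg_right (le_abs_self γ) hA.le))
    calc hK K / area K * (C₁ * hK K ^ 3) = C₁ * (hK K ^ 2 / area K) * hK K ^ 2 := by ring
      _ ≤ _ := by gcongr
  calc _ ≤ 7 * massBound * 720 * (C₁ * |γ| * hK K ^ 2)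
        + (1 + 420 * massBound) * (B' * hK K ^ 2) := by gcongr
    _ = _ := by ring

/-- For the exact solution the rate of change of the cell average is its boundary flux. -/
lemma IsSmoothSolution.cellDefect_eq {D : Set (State m)} {f : Fin 2 → State m → State m}
    {T : ℝ} {u : ℝ → Plane → State m} (hu : IsSmoothSolution D f T u)
    (hf : ∀ k, ContDiffOn ℝ 1 (f k) D) (hT : 0 < T) {t : ℝ} (ht : t ∈ Icc 0 T) (K : Tri)
    (tr : Plane → State m) :
    cellDefect K f T u t tr = boundaryFlux K (fun _ => 1) (fun k x => f k (tr x))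
      - boundaryFlux K (fun _ => 1) (fun k x => f k (u t x)) := by
  rw [cellDefect]
  simp only [cellAverage_interp]
  rw [derivWithin_cellAverage hT hu.contDiffOn K ht, cellAverage, smul_smul,
    mul_inv_cancel₀ (area_pos K).ne', one_smul,
    boundaryFlux_eq_integral_div K (hu.contDiff_flux hf ht)]
  simp only [eq_neg_of_add_eq_zero_left (hu.equation t ht _), integral_neg]
  abel

lemma boundaryFlux_const_smul (K : Tri) (c : ℝ) (G : Fin 2 → Plane → State m) :
    c • boundaryFlux K (fun _ => 1) G = boundaryFlux K (fun _ => 1) fun k x => c • G k x := by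
  rw [← boundaryFlux_smul K (fun _ => c)]
  simp only [boundaryFlux, Finset.smul_sum, ← intervalIntegral.integral_smul, one_smul]

/-! ### Summation over the mesh -/

namespace Triangulation

variable {𝒯 : Triangulation}

/-- A sum over nodes weighted by the increments of a Lipschitz test function. -/
lemma norm_finsum_nodes_le {φ : Plane → ℝ} {Lφ : ℝ} (hφL : ∀ x y, |φ x - φ y| ≤ Lφ * ‖x - y‖)
    (hLφ : 0 ≤ Lφ) {h M : ℝ} (hh : 𝒯.MeshSizeLE h) (hM : 0 ≤ M) {F : Finset 𝒯.Cell}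
    (hF : ∀ K ∉ F, ∀ x ∈ carrier (𝒯.tri K), φ x = 0) {S : Set Plane} (hS : volume S ≠ ⊤)
    (hFS : ∀ K ∈ F, carrier (𝒯.tri K) ⊆ S) {d : 𝒯.Cell → LocalNode → State m}
    (hd : ∀ K ∈ F, ∀ j, ‖d K j‖ ≤ M) :
    ‖∑ᶠ K : 𝒯.Cell, ∑ j : LocalNode,
      (beta j * area (𝒯.tri K) * (φ (node (𝒯.tri K) j) - φ (centroid (𝒯.tri K)))) • d K j‖ ≤
      6 * Lφ * volume.real S * (h * M) := by
  rw [finsum_eq_sum_of_support_subset (s := F)]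
  · have hterm : ∀ K ∈ F, ‖∑ j : LocalNode, (beta j * area (𝒯.tri K) *
        (φ (node (𝒯.tri K) j) - φ (centroid (𝒯.tri K)))) • d K j‖ ≤
        6 * (area (𝒯.tri K) * (Lφ * h) * M) := by
      intro K hKF
      refine (norm_sum_le_of_le _ (n := fun _ => area (𝒯.tri K) * (Lφ * h) * M)
        fun j _ => ?_).trans_eq (by simp)
      have hA := area_pos (𝒯.tri K)
      have hb : |beta j| ≤ 1 := by
        rcases j with j | j <;> norm_num [beta, abs_of_pos]
      have hinc : |φ (node (𝒯.tri K) j) - φ (centroid (𝒯.tri K))| ≤ Lφ * h :=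
        (hφL _ _).trans (mul_le_mul_of_nonneg_left ((dist_le_hK _ (node_mem _ _)
          (centroid_mem _)).trans (hh K)) hLφ)
      rw [norm_smul, Real.norm_eq_abs, abs_mul, abs_mul, abs_of_pos hA]
      have h1 : |beta j| * area (𝒯.tri K) ≤ area (𝒯.tri K) :=
        mul_le_of_le_one_left hA.le hb
      have h2 := (abs_nonneg _).trans hinc
      gcongr
      exact hd K hKF j
    refine (norm_sum_le_of_le _ hterm).trans ?_
    have harea := 𝒯.sum_area_le F hFS hS
    have hh0 : 0 ≤ h := by
      obtain ⟨K, _⟩ := 𝒯.covers 0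
      exact (hK_pos (𝒯.tri K)).le.trans (hh K)
    calc ∑ K ∈ F, 6 * (area (𝒯.tri K) * (Lφ * h) * M)
        = (∑ K ∈ F, area (𝒯.tri K)) * (6 * Lφ * (h * M)) := by
          rw [Finset.sum_mul]
          exact Finset.sum_congr rfl fun K _ => by ring
      _ ≤ volume.real S * (6 * Lφ * (h * M)) := by gcongr
      _ = _ := by ring
  · intro K hKs
    by_contra hKF
    apply hKs
    refine Finset.sum_eq_zero fun j _ => ?_
    rw [hF K hKF _ (node_mem _ _), hF K hKF _ (centroid_mem _)]
    simp

/-- The boundary fluxes of a field that is small on every triangle, weighted by the values of a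
test function at the centroids. -/
lemma norm_sum_flux_le {φ : Plane → ℝ} {Lφ : ℝ} (hφc : Continuous φ)
    (hφL : ∀ x y, |φ x - φ y| ≤ Lφ * ‖x - y‖) (hLφ : 0 ≤ Lφ) {h γ C R : ℝ}
    (hh : 𝒯.MeshSizeLE h) (hγ : 𝒯.Regular γ) (hC : 0 ≤ C)
    (hφR : ∀ x, R < ‖x‖ → φ x = 0) {F : Finset 𝒯.Cell}
    (hF : ∀ K, (carrier (𝒯.tri K) ∩ Metric.closedBall 0 (R + 1)).Nonempty → K ∈ F)
    {S : Set Plane} (hS : volume S ≠ ⊤) (hFS : ∀ K ∈ F, carrier (𝒯.tri K) ⊆ S)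
    {g : Fin 2 → Plane → State m} (hg : ∀ K ∈ F, ∀ k, ContinuousOn (g k) (carrier (𝒯.tri K)))
    (hgb : ∀ K ∈ F, ∀ k, ∀ x ∈ carrier (𝒯.tri K), ‖g k x‖ ≤ C * hK (𝒯.tri K) ^ 3) :
    ‖∑ K ∈ F, φ (centroid (𝒯.tri K)) • boundaryFlux (𝒯.tri K) (fun _ => 1) g‖ ≤
      6 * Lφ * C * |γ| * volume.real S * h ^ 3 := by
  have hFφ : ∀ K ∉ F, ∀ x ∈ carrier (𝒯.tri K), φ x = 0 := by
    intro K hKF x hx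
    apply hφR
    by_contra! hxR
    exact hKF (hF K ⟨x, hx, by rw [mem_closedBall_zero_iff]; linarith⟩)
  have hG : ∀ k, Continuous fun x => φ x • g k x := by
    intro k
    refine 𝒯.continuous_of_continuousOn fun K => ?_
    by_cases hKF : K ∈ F
    · exact hφc.continuousOn.smul (hg K hKF k)
    · refine (continuousOn_const (c := (0 : State m))).congr fun x hx => ?_
      simp only [hFφ K hKF x hx, zero_smul]
  -- Subtracting this vanishing sum replaces `φ(x_K)` by `φ(x_K) - φ(x)` on each boundary, which
  -- gains one order.
  have h0 := 𝒯.sum_boundaryFlux_eq_zero hG (R := R)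
    (fun k x hx => by simp only [hφR x hx, zero_smul]) F hF
  have hh0 : 0 ≤ h := by
    obtain ⟨K, _⟩ := 𝒯.covers 0
    exact (hK_pos (𝒯.tri K)).le.trans (hh K)
  rw [← sub_zero (∑ K ∈ F, _), ← h0, ← Finset.sum_sub_distrib]
  have hterm : ∀ K ∈ F, ‖φ (centroid (𝒯.tri K)) • boundaryFlux (𝒯.tri K) (fun _ => 1) g
      - boundaryFlux (𝒯.tri K) (fun _ => 1) (fun k x => φ x • g k x)‖ ≤
      6 * Lφ * C * |γ| * h ^ 3 * area (𝒯.tri K) := by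
    intro K hKF
    rw [boundaryFlux_const_smul, ← boundaryFlux_sub _
      (G := fun k x => φ (centroid (𝒯.tri K)) • g k x)
      (fun k => (hg K hKF k).const_smul (φ (centroid (𝒯.tri K)))) fun k => (hG k).continuousOn]
    have hpos := hK_pos (𝒯.tri K)
    refine (norm_boundaryFlux_le _ (ε := Lφ * hK (𝒯.tri K) * (C * hK (𝒯.tri K) ^ 3))
      fun k x hx => ?_).trans ?_
    · rw [one_smul, ← sub_smul, norm_smul]
      refine mul_le_mul ((hφL _ _).trans ?_) (hgb K hKF k x hx) (norm_nonneg _) (by positivity)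
      exact mul_le_mul_of_nonneg_left (dist_le_hK _ (centroid_mem _) hx) hLφ
    · have hA := area_pos (𝒯.tri K)
      have h2 : hK (𝒯.tri K) ^ 2 ≤ |γ| * area (𝒯.tri K) := (hγ K).trans
        (mul_le_mul_of_nonneg_right (le_abs_self γ) hA.le)
      have h3 : hK (𝒯.tri K) ^ 3 ≤ h ^ 3 := pow_le_pow_left₀ hpos.le (hh K) 3
      calc 6 * hK (𝒯.tri K) * (Lφ * hK (𝒯.tri K) * (C * hK (𝒯.tri K) ^ 3))
          = 6 * Lφ * C * (hK (𝒯.tri K) ^ 2 * hK (𝒯.tri K) ^ 3) := by ring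
        _ ≤ 6 * Lφ * C * ((|γ| * area (𝒯.tri K)) * h ^ 3) := by gcongr
        _ = _ := by ring
  refine (norm_sum_le_of_le _ hterm).trans ?_
  rw [← Finset.mul_sum]
  have harea := 𝒯.sum_area_le F hFS hS
  calc _ ≤ 6 * Lφ * C * |γ| * h ^ 3 * volume.real S := by gcongr
    _ = _ := by ring

end Triangulation

end Pampa

/-! ### Assembly of the three estimates -/

theorem mainTheorem1 {m : ℕ} (D : Set (Pampa.State m)) (hDo : IsOpen D) (hDc : Convex ℝ D)
    (f : Fin 2 → Pampa.State m → Pampa.State m) (hf : ∀ k, ContDiffOn ℝ 1 (f k) D)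
    (T : ℝ) (hT : 0 < T) (u : ℝ → Pampa.Plane → Pampa.State m)
    (hu : Pampa.IsSmoothSolution D f T u)
    (φ : Pampa.Plane → ℝ) (hφ : ContDiff ℝ 1 φ) (hφc : HasCompactSupport φ)
    (γ Cω : ℝ) :
    ∃ C h₀ : ℝ, 0 < h₀ ∧
      ∀ (𝒯 : Pampa.Triangulation) (h : ℝ), h ≤ h₀ → 𝒯.MeshSizeLE h → 𝒯.Regular γ →
      ∀ t ∈ Set.Icc 0 T,
      ∀ ω : 𝒯.Cell → Pampa.LocalNode → (Pampa.State m →L[ℝ] Pampa.State m),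
        𝒯.SumToId ω → (∀ K j, ‖ω K j‖ ≤ Cω) →
        -- boundary fluxes of the interpolant of the exact solution
        ‖Pampa.truncationError 𝒯 f T u φ t ω (fun K => Pampa.interp (𝒯.tri K) (u t))‖
            ≤ C * h ^ 3 ∧
        -- boundary fluxes of the exact solution itself
        ‖Pampa.truncationError 𝒯 f T u φ t ω (fun _ => u t)‖ ≤ C * h ^ 3 ∧
        -- the defect of the scheme itself
        ‖Pampa.testedDefect 𝒯 f T u φ t ω‖ ≤ C * h ^ 3 := by
  open Pampa in
  obtain ⟨R, hR⟩ := hφc.isCompact.isBounded.subset_closedBall 0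
  have hφR : ∀ x, R < ‖x‖ → φ x = 0 := fun x hx =>
    image_eq_zero_of_notMem_tsupport fun h => hx.not_ge (mem_closedBall_zero_iff.1 (hR h))
  obtain ⟨Lφ, hLip⟩ := hφ.lipschitzWith_of_hasCompactSupport hφc one_ne_zero
  have hφL : ∀ x y, |φ x - φ y| ≤ Lφ * ‖x - y‖ := fun x y => by
    simpa [Real.dist_eq, dist_eq_norm] using hLip.dist_le_mul x y
  -- The support of `φ` lies in radius `R`, the cells of `F` meet radius `R + 1` and lie in `R + 2`,
  -- and any cell sharing a node with them lies in `R + 3`, since `h ≤ 1`.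
  obtain ⟨C, h₀, hC, hh₀, hloc⟩ := exists_local_estimates hDo hf hT hu (R + 3) γ
  set V := volume.real (Metric.ball (0 : Plane) 1)
  set S : Set Plane := Metric.closedBall 0 (R + 3)
  have hS : volume S ≠ ⊤ := measure_closedBall_lt_top.ne
  set N := 6 * (|γ| * V) * (|Cω| * C) with hN
  set C₁ := 6 * Lφ * C * |γ| * volume.real S with hC₁
  set C₂ := 6 * Lφ * volume.real S * (|Cω| * C) with hC₂
  set C₃ := 6 * Lφ * volume.real S * N with hC₃
  have hV : 0 ≤ V := measureReal_nonneg
  have hVS : 0 ≤ volume.real S := measureReal_nonneg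
  have hN0 : 0 ≤ N := by positivity
  have hC₁0 : 0 ≤ C₁ := by positivity
  have hC₂0 : 0 ≤ C₂ := by positivity
  have hC₃0 : 0 ≤ C₃ := by positivity
  refine ⟨C₁ + C₂ + C₃, min 1 h₀, lt_min one_pos hh₀, fun 𝒯 h hh hmesh hreg t ht ω hω hωb => ?_⟩
  have hmesh' : ∀ K, hK (𝒯.tri K) ≤ h := hmesh
  have hpos : 0 < h := by
    obtain ⟨K, _⟩ := 𝒯.covers 0
    exact (hK_pos (𝒯.tri K)).trans_le (hmesh K)
  have hh1 : h ≤ 1 := hh.trans (min_le_left _ _)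
  have hsub : ∀ K x r, x ∈ carrier (𝒯.tri K) → ‖x‖ ≤ r →
      carrier (𝒯.tri K) ⊆ Metric.closedBall 0 (r + 1) := by
    intro K x r hx hr y hy
    rw [mem_closedBall_zero_iff]
    have h1 := dist_le_hK _ hy hx
    have h2 := hmesh' K
    have h3 := norm_sub_norm_le y x
    linarith
  have hfin := 𝒯.finite_meets (isCompact_closedBall (0 : Plane) (R + 1))
  set F := hfin.toFinset
  have hF : ∀ K, (carrier (𝒯.tri K) ∩ Metric.closedBall 0 (R + 1)).Nonempty → K ∈ F :=
    fun K hKm => hfin.mem_toFinset.2 hKm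
  have hFR : ∀ K ∈ F, carrier (𝒯.tri K) ⊆ Metric.closedBall 0 (R + 2) := by
    intro K hKF
    obtain ⟨x, hx, hxR⟩ := hfin.mem_toFinset.1 hKF
    have := hsub K x (R + 1) hx (mem_closedBall_zero_iff.1 hxR)
    rwa [add_assoc, one_add_one_eq_two] at this
  have hFS : ∀ K ∈ F, carrier (𝒯.tri K) ⊆ S := fun K hKF =>
    (hFR K hKF).trans (Metric.closedBall_subset_closedBall (by linarith))
  have hFφ : ∀ K ∉ F, ∀ x ∈ carrier (𝒯.tri K), φ x = 0 := by
    intro K hKF x hx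
    apply hφR
    by_contra! hxR
    exact hKF (hF K ⟨x, hx, by rw [mem_closedBall_zero_iff]; linarith⟩)
  have hlocal : ∀ K, carrier (𝒯.tri K) ⊆ S → _ := fun K hKS =>
    hloc t ht (𝒯.tri K) hKS ((hmesh' K).trans (hh.trans (min_le_right _ _))) (hreg K)
  have hpt : ∀ K, carrier (𝒯.tri K) ⊆ S → ∀ j,
      ‖derivWithin (fun s => u s (node (𝒯.tri K) j)) (Icc 0 T) t
        + residual (𝒯.tri K) f (interp (𝒯.tri K) (u t)) j‖ ≤ C * h ^ 2 := fun K hKS j =>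
    ((hlocal K hKS).2.2 j).trans (mul_le_mul_of_nonneg_left
      (pow_le_pow_left₀ (hK_pos _).le (hmesh' K) 2) hC)
  have hcell : ‖∑ᶠ K : 𝒯.Cell, φ (centroid (𝒯.tri K)) •
      cellDefect (𝒯.tri K) f T u t (interp (𝒯.tri K) (u t))‖ ≤ C₁ * h ^ 3 := by
    rw [finsum_eq_sum_of_support_subset (s := F)]
    -- The glued interpolant makes the flux difference a single field on the plane, as the
    -- cancellation requires.
    · have hcong : ∀ K ∈ F, cellDefect (𝒯.tri K) f T u t (interp (𝒯.tri K) (u t)) =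
          boundaryFlux (𝒯.tri K) (fun _ => 1) fun k x => f k (𝒯.glue (u t) x) - f k (u t x) := by
        intro K hKF
        rw [hu.cellDefect_eq hf hT ht, ← boundaryFlux_sub _ (hlocal K (hFS K hKF)).1
          fun k => (hu.contDiff_flux hf ht k).continuous.continuousOn]
        exact Triangulation.boundaryFlux_congr _ (fun _ _ => rfl) fun k x hx => by
          rw [𝒯.glue_eq (u t) hx]
      rw [Finset.sum_congr rfl fun K hKF => by rw [hcong K hKF]]
      refine Triangulation.norm_sum_flux_le hφ.continuous hφL Lφ.coe_nonneg hmesh hreg hC hφR hF hS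
        hFS (fun K hKF k => ?_) fun K hKF k x hx => ?_
      · refine ContinuousOn.sub ?_ (hu.contDiff_flux hf ht k).continuous.continuousOn
        exact ((hlocal K (hFS K hKF)).1 k).congr fun x hx => by simp only [𝒯.glue_eq (u t) hx]
      · rw [𝒯.glue_eq (u t) hx]
        exact (hlocal K (hFS K hKF)).2.1 k x hx
    · intro K hKs
      by_contra hKF
      apply hKs
      simp only [hFφ K hKF _ (centroid_mem _), zero_smul]
  have hnodes : ‖∑ᶠ K : 𝒯.Cell, ∑ j : LocalNode,
      (beta j * area (𝒯.tri K) * (φ (node (𝒯.tri K) j) - φ (centroid (𝒯.tri K)))) •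
        ω K j (derivWithin (fun s => u s (node (𝒯.tri K) j)) (Icc 0 T) t
          + residual (𝒯.tri K) f (interp (𝒯.tri K) (u t)) j)‖ ≤ C₂ * h ^ 3 := by
    refine (Triangulation.norm_finsum_nodes_le hφL Lφ.coe_nonneg hmesh
      (M := |Cω| * (C * h ^ 2)) (by positivity) hFφ hS hFS fun K hKF j => ?_).trans_eq ?_
    · refine (ContinuousLinearMap.le_opNorm _ _).trans ?_
      exact mul_le_mul ((hωb K j).trans (le_abs_self _)) (hpt K (hFS K hKF) j) (norm_nonneg _)
        (abs_nonneg _)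
    · rw [hC₂]
      ring
  have hpoint : ‖∑ᶠ K : 𝒯.Cell, ∑ j : LocalNode,
      (beta j * area (𝒯.tri K) * (φ (node (𝒯.tri K) j) - φ (centroid (𝒯.tri K)))) •
        pointDefect 𝒯 f T u t ω (node (𝒯.tri K) j)‖ ≤ C₃ * h ^ 3 := by
    refine (Triangulation.norm_finsum_nodes_le hφL Lφ.coe_nonneg hmesh
      (M := N * h ^ 2) (by positivity) hFφ hS hFS fun K hKF j => ?_).trans_eq ?_
    · refine (Triangulation.norm_pointDefect_le hreg hω hωb (ε := C * h ^ 2)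
        fun K' j' hn => hpt K' ?_ j').trans ?_
      · have h1 := hsub K' _ (R + 2) (node_mem (𝒯.tri K') j')
          (hn ▸ mem_closedBall_zero_iff.1 (hFR K hKF (node_mem _ j)))
        refine h1.trans (Metric.closedBall_subset_closedBall (by linarith))
      · have hCω := (norm_nonneg _).trans (hωb K j)
        rw [hN, mul_assoc _ (|Cω| * C), mul_assoc |Cω|]
        gcongr
        · exact le_abs_self γ
        · exact le_abs_self Cω
    · rw [hC₃]
      ring
  have h3 : 0 ≤ h ^ 3 := by positivity
  have hm1 := mul_nonneg hC₁0 h3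
  have hm2 := mul_nonneg hC₂0 h3
  have hm3 := mul_nonneg hC₃0 h3
  refine ⟨(norm_add_le _ _).trans ?_, ?_, (norm_add_le _ _).trans ?_⟩
  · linarith
  -- With exact fluxes every cell defect vanishes, so only the point terms remain.
  · have hz : (∑ᶠ K : 𝒯.Cell, φ (centroid (𝒯.tri K)) • cellDefect (𝒯.tri K) f T u t (u t)) = 0 := by
      simp only [hu.cellDefect_eq hf hT ht, sub_self, smul_zero, finsum_zero]
    rw [truncationError, hz, zero_add]
    linarith
  · linarith
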